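/- Let $a,b,c$ be integers with $a\neq 0$, $c\neq 0$ and $\gcd(a,b)=1$, and let $k,\ell\geq 2$ be integers with $k\notin\{3,5\}$. Put $$S_{a,b}^k(x)=\frac{a^k}{k+1}\left(B_{k+1}\left(x+\frac ba\right)-B_{k+1}\left(\frac ba\right)\right),\qquad R_c^{\ell}(x)=x(x+c)(x+2c)\cdots(x+(\ell-1)c),$$ where $B_{k+1}$ is the Bernoulli polynomial; thus $S_{a,b}^k(n)=b^k+(a+b)^k+\cdots+(a(n-1)+b)^k$ for all integers $n\geq 1$. Then there exist no polynomial $p(x)\in\mathbb C[x]$ and no $\alpha,\beta,\gamma,\delta\in\mathbb C$ such that $$S_{a,b}^k(x)=R_c^{\ell}\left(p(x)\sqrt{\alpha x^2+\beta x+\gamma}+\delta\right)$$ identically in $x$. Here the identity is excluded for every choice of the square root: there is no function $w:\mathbb C\to\mathbb C$ with $w(x)^2=\alpha x^2+\beta x+\gamma$ and $S_{a,b}^k(x)=R_c^{\ell}(p(x)w(x)+\delta)$ for all $x\in\mathbb C$. -/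

import Mathlib

open Polynomial

/-- The polynomial `S_{a,b}^k(x) = b^k + (a+b)^k + (2a+b)^k + ⋯ + (a(x-1)+b)^k` for `a ≠ 0`, given as
`(a^k/(k+1)) (B_{k+1}(x + b/a) - B_{k+1}(b/a))` with `B_{k+1}` the Bernoulli polynomial.
`eval_powerSumPoly` shows that it takes the values of the power sum, which determine it. -/
noncomputable def powerSumPoly (a b : ℤ) (k : ℕ) : ℚ[X] :=
  C ((a : ℚ) ^ k / ((k : ℚ) + 1)) *
    ((Polynomial.bernoulli (k + 1)).comp (X + C ((b : ℚ) / (a : ℚ))) -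
      C ((Polynomial.bernoulli (k + 1)).eval ((b : ℚ) / (a : ℚ))))

/-- The polynomial `R_c^ℓ(x) = x (x+c) (x+2c) ⋯ (x+(ℓ-1)c)`. -/
noncomputable def progressionPoly (c : ℤ) (l : ℕ) : ℚ[X] :=
  ∏ i ∈ Finset.range l, (X + C ((i : ℚ) * (c : ℚ)))

/-- At a natural number `n`, `S_{a,b}^k` is the sum of the `k`-th powers of the first `n` terms of
the arithmetic progression `b, a+b, 2a+b, …`. -/
theorem eval_powerSumPoly (a b : ℤ) (ha : a ≠ 0) (k n : ℕ) :
    (powerSumPoly a b k).eval (n : ℚ) =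
      ∑ i ∈ Finset.range n, ((a : ℚ) * (i : ℚ) + (b : ℚ)) ^ k := by
  have ha' : (a : ℚ) ≠ 0 := by exact_mod_cast ha
  have hk : ((k : ℚ) + 1) ≠ 0 := by positivity
  induction n with
  | zero => simp [powerSumPoly]
  | succ n ih =>
    rw [Finset.sum_range_succ, ← ih]
    have h := Polynomial.bernoulli_eval_one_add (k + 1) ((n : ℚ) + (b : ℚ) / (a : ℚ))
    have e : (a : ℚ) * (n : ℚ) + (b : ℚ) = (a : ℚ) * ((n : ℚ) + (b : ℚ) / (a : ℚ)) := by
      field_simp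
    have e2 : ((n + 1 : ℕ) : ℚ) + (b : ℚ) / (a : ℚ) = 1 + ((n : ℚ) + (b : ℚ) / (a : ℚ)) := by
      push_cast; ring
    simp only [powerSumPoly, eval_mul, eval_sub, eval_C, eval_comp, eval_add, eval_X]
    rw [e2, h, e, mul_pow]
    push_cast
    field_simp
    ring

/-!
Write `n = k + 1`. Up to scaling and translation, `S_{a,b}^k` is `B_n + b` with `B_n` the Bernoulli
polynomial, so the question is how `B_n + b` can be decomposed.

The square root is removed by splitting `R_c^l(δ + y) = e(y²) + y o(y²)`. Either `p² (αx² + βx +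
γ)` is the square of a polynomial, which can then replace the square root, or `o = 0`, which forces
`l = 2m` and centres the zeros of `R_c^l` at `δ`. So `S = R_c^l ∘ P` with `l` odd, or `S = E_m ∘
(p² q)` with `deg q ≤ 2`, `l = 2m` and `E_m(y²) = R_c^l(y - (2m - 1)c/2)`
(`exists_polynomial_representation`).

If the outer factor has degree at least `2`, the inner factor has degree at most `2`
(`eq_sq_of_bern_eq_comp`). Indeed if `B_n = f ∘ g`, then `g(x+1) - g(x)` divides `B_n(x+1) - B_n(x)
= n x^(n-1)`, so it is a constant times a power of `x`. Hence `g` is affinely equivalent to a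
Bernoulli polynomial `B_d`, and the coefficient of `x^(n-2)` excludes `d ≥ 3`. There remain the
inner factors `x - 1/2` and `(x - 1/2)²`, up to affine maps. They would put the roots of `B_n + b`,
or of `B_n + b` as a polynomial in `(x - 1/2)²`, in arithmetic progression or in affine position
with the squares of the first odd numbers. Newton's identities give the low power sums of these
roots, which are of neither kind (`bern_ne_prod_linear`, `bern_ne_prod_sq_linear`,
`bern_ne_prod_odd_sq`, `bern_ne_prod_sq_odd_sq`), except for `n = 3`, where arithmetic conditions
on `a`, `b`, `c` decide.

For `l = 2` the outer factor is linear and the claim is that `F = B_n + b` is not `p² q` with `deg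
q ≤ 2` (`bern_add_const_ne_sq_mul`), for complex `b` if `n ≥ 5`, `n ≠ 6`. Because `F(x+1) - F(x) =
n x^(n-1)`, the polynomial `N = x F' - (n - 1) F` does not change when `F(x)` is replaced by
`F(x+1)`, and so it is divisible by `p(x) p(x+1)` (`mul_comp_dvd_of_sq_mul`). The cofactor `T` has
degree `deg q`, and `N² q(x) q(x+1) = T² F(x) F(x+1)`. In this identity `q` and `T` hold at most
four unknowns, while the top coefficients of `N`, `F(x)` and `F(x+1)` are explicit polynomials in
`n` that do not involve `b`. Eliminating the unknowns leaves a polynomial condition on `n` which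
fails for the `n` in question, except for `n = 10`, where one further coefficient decides.
-/

/-! ### Bernoulli polynomials with complex coefficients -/

/-- The Bernoulli polynomial `B_n`, with complex coefficients. -/
noncomputable def bern (n : ℕ) : ℂ[X] := (Polynomial.bernoulli n).map (algebraMap ℚ ℂ)

theorem bern_comp_add_one (n : ℕ) : (bern n).comp (X + 1) = bern n + (n : ℂ[X]) * X ^ (n - 1) := by
  have h := congrArg (Polynomial.map (algebraMap ℚ ℂ)) (Polynomial.bernoulli_comp_one_add_X n)
  simp only [Polynomial.map_comp, Polynomial.map_add, Polynomial.map_one, Polynomial.map_X] at h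
  rw [bern, add_comm X, h]
  simp

theorem derivative_bern_succ (n : ℕ) : derivative (bern (n + 1)) = ((n : ℂ[X]) + 1) * bern n := by
  rw [bern, Polynomial.derivative_map, Polynomial.derivative_bernoulli]
  simp [bern]

/-- Addition formula: `B_{i+j}(x + r)` has `x ^ i`-coefficient `(i+j choose j) B_j(r)`. -/
theorem coeff_bern_comp (r : ℂ) (i j : ℕ) :
    ((bern (i + j)).comp (X + C r)).coeff i = ((i + j).choose j : ℂ) * (bern j).eval r := by
  induction i with
  | zero => simp [coeff_zero_eq_eval_zero, eval_comp]
  | succ i ih =>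
    have h := congrArg (fun f : ℂ[X] => f.coeff i)
      (congrArg (fun f : ℂ[X] => f.comp (X + C r)) (derivative_bern_succ (i + j)))
    have hd : derivative ((bern (i + j + 1)).comp (X + C r)) =
        (derivative (bern (i + j + 1))).comp (X + C r) := by
      rw [derivative_comp]; simp
    rw [← hd, coeff_derivative] at h
    have hc : ((((i + j : ℕ) : ℂ[X]) + 1) * bern (i + j)).comp (X + C r) =
        C (((i + j : ℕ) : ℂ) + 1) * (bern (i + j)).comp (X + C r) := by simp
    rw [hc, coeff_C_mul, ih] at h
    have e : i + 1 + j = i + j + 1 := by ring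
    have hchoose : ((i + j + 1).choose j : ℂ) * (i + 1) = (i + j + 1) * ((i + j).choose j) := by
      have := Nat.choose_mul_succ_eq (i + j) j
      have e2 : i + j + 1 - j = i + 1 := by omega
      rw [e2] at this
      have h3 : ((i + j).choose j : ℂ) * (i + j + 1) = ((i + j + 1).choose j) * (i + 1) := by
        exact_mod_cast this
      linear_combination -h3
    have hi : ((i : ℂ) + 1) ≠ 0 := by exact_mod_cast Nat.succ_ne_zero i
    rw [e]
    apply mul_right_cancel₀ hi
    rw [h]
    push_cast
    linear_combination -(eval r (bern j)) * hchoose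

theorem natDegree_bern (n : ℕ) : (bern n).natDegree = n := by
  apply le_antisymm
  · rw [natDegree_le_iff_coeff_eq_zero]
    intro N hN
    rw [bern, coeff_map, Polynomial.coeff_bernoulli]
    simp [Nat.not_le.mpr hN]
  · apply le_natDegree_of_ne_zero
    rw [bern, coeff_map, Polynomial.coeff_bernoulli]
    simp

theorem monic_bern (n : ℕ) : (bern n).Monic := by
  rw [Monic, leadingCoeff, natDegree_bern, bern, coeff_map, Polynomial.coeff_bernoulli]
  simp

theorem bernoulli_five : _root_.bernoulli 5 = 0 :=
  bernoulli_eq_zero_of_odd (by decide) (by norm_num)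
theorem bernoulli_seven : _root_.bernoulli 7 = 0 :=
  bernoulli_eq_zero_of_odd (by decide) (by norm_num)
theorem bernoulli_three : _root_.bernoulli 3 = 0 :=
  bernoulli_eq_zero_of_odd (by decide) (by norm_num)
theorem bernoulli_four : _root_.bernoulli 4 = -1 / 30 := by
  rw [bernoulli_eq_bernoulli'_of_ne_one (by norm_num), bernoulli'_four]
theorem bernoulli_six : _root_.bernoulli 6 = 1 / 42 := by
  have h := _root_.sum_bernoulli 7
  simp [Finset.sum_range_succ, bernoulli_three, bernoulli_four, bernoulli_five,
    Nat.choose] at h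
  linarith
theorem bernoulli_eight : _root_.bernoulli 8 = -1 / 30 := by
  have h := _root_.sum_bernoulli 9
  simp [Finset.sum_range_succ, bernoulli_three, bernoulli_four, bernoulli_five,
    bernoulli_six, bernoulli_seven, Nat.choose] at h
  linarith

theorem eval_bern_ratCast (n : ℕ) (r : ℚ) :
    (bern n).eval (r : ℂ) = (((Polynomial.bernoulli n).eval r : ℚ) : ℂ) := by
  rw [bern, eval_map, show (r : ℂ) = algebraMap ℚ ℂ r from rfl, eval₂_at_apply]; rfl

theorem eval_bern_zero (n : ℕ) : (bern n).eval 0 = ((_root_.bernoulli n : ℚ) : ℂ) := by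
  have := eval_bern_ratCast n 0
  rwa [Polynomial.bernoulli_eval_zero, Rat.cast_zero] at this

theorem eval_bern_one {n : ℕ} (hn : n ≠ 1) :
    (bern n).eval 1 = ((_root_.bernoulli n : ℚ) : ℂ) := by
  have := eval_bern_ratCast n 1
  rwa [Polynomial.bernoulli_eval_one, Rat.cast_one, ← bernoulli_eq_bernoulli'_of_ne_one hn] at this

theorem eval_bern_one_one : (bern 1).eval 1 = 1 / 2 := by
  have := eval_bern_ratCast 1 1
  rw [Polynomial.bernoulli_eval_one, bernoulli'_one, Rat.cast_one] at this
  rw [this]; norm_num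

theorem eval_bern_half (n : ℕ) :
    (bern n).eval (1 / 2 : ℂ) = ((∑ i ∈ Finset.range (n + 1),
      _root_.bernoulli i * (n.choose i) * (1 / 2) ^ (n - i) : ℚ) : ℂ) := by
  have := eval_bern_ratCast n (1 / 2)
  rw [Polynomial.bernoulli] at this
  simp only [eval_finsetSum, eval_monomial] at this
  push_cast at this ⊢
  exact_mod_cast this

theorem bern_half_values :
    (bern 0).eval (1 / 2 : ℂ) = 1 ∧ (bern 1).eval (1 / 2 : ℂ) = 0 ∧
    (bern 2).eval (1 / 2 : ℂ) = -1 / 12 ∧ (bern 3).eval (1 / 2 : ℂ) = 0 ∧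
    (bern 4).eval (1 / 2 : ℂ) = 7 / 240 ∧ (bern 6).eval (1 / 2 : ℂ) = -31 / 1344 := by
  simp only [eval_bern_half, Finset.sum_range_succ, Finset.sum_range_zero, bernoulli_three,
    bernoulli_four, bernoulli_five, bernoulli_six, _root_.bernoulli_zero, _root_.bernoulli_one,
    _root_.bernoulli_two, Nat.choose]
  norm_num

theorem cast_choose_succ (n j : ℕ) :
    ((n.choose (j + 1) : ℕ) : ℂ) = n.choose j * (n - j) / (j + 1) := by
  have hj : ((j : ℂ) + 1) ≠ 0 := by exact_mod_cast Nat.succ_ne_zero j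
  rw [eq_div_iff hj]
  have h := Nat.choose_succ_right_eq n j
  rcases le_or_gt j n with hjn | hjn
  · have : ((n - j : ℕ) : ℂ) = n - j := by push_cast [hjn]; ring
    rw [← this]; exact_mod_cast h
  · simp [Nat.choose_eq_zero_of_lt hjn, Nat.choose_eq_zero_of_lt (Nat.lt_succ_of_lt hjn)]

/-- The coefficients of a translate of `B_n`, counted from the top. -/
theorem coeff_reflect_bern_comp (r b : ℂ) {n j : ℕ} (hj : j < n) :
    (reflect n ((bern n).comp (X + C r) + C b)).coeff j = (n.choose j : ℂ) * (bern j).eval r := by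
  obtain ⟨i, rfl⟩ := Nat.exists_eq_add_of_lt hj
  rw [coeff_reflect, revAt_le (by omega), show j + i + 1 - j = i + 1 by omega, coeff_add,
    coeff_C_of_ne_zero (by omega), add_zero, show j + i + 1 = (i + 1) + j by ring, coeff_bern_comp]

/-! ### Shifted Bernoulli polynomials are not a square times a quadratic -/

theorem choose_values (n : ℕ) : ((n.choose 2 : ℕ) : ℂ) = n * (n - 1) / 2 ∧
    ((n.choose 4 : ℕ) : ℂ) = n * (n - 1) * (n - 2) * (n - 3) / 24 ∧
    ((n.choose 6 : ℕ) : ℂ) = n * (n - 1) * (n - 2) * (n - 3) * (n - 4) * (n - 5) / 720 := by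
  simp only [cast_choose_succ, Nat.choose_zero_right]
  push_cast
  refine ⟨?_, ?_, ?_⟩ <;> ring

theorem coeff_mul_upto_four (f g : ℂ[X]) :
    (f * g).coeff 0 = f.coeff 0 * g.coeff 0 ∧
    (f * g).coeff 1 = f.coeff 0 * g.coeff 1 + f.coeff 1 * g.coeff 0 ∧
    (f * g).coeff 2 = f.coeff 0 * g.coeff 2 + f.coeff 1 * g.coeff 1 + f.coeff 2 * g.coeff 0 ∧
    (f * g).coeff 3 = f.coeff 0 * g.coeff 3 + f.coeff 1 * g.coeff 2 + f.coeff 2 * g.coeff 1 +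
      f.coeff 3 * g.coeff 0 ∧
    (f * g).coeff 4 = f.coeff 0 * g.coeff 4 + f.coeff 1 * g.coeff 3 + f.coeff 2 * g.coeff 2 +
      f.coeff 3 * g.coeff 1 + f.coeff 4 * g.coeff 0 := by
  simp [coeff_mul, Finset.Nat.antidiagonal_succ]
  refine ⟨?_, ?_, ?_⟩ <;> ring

theorem coeff_mul_six (f g : ℂ[X]) :
    (f * g).coeff 6 = f.coeff 0 * g.coeff 6 + f.coeff 1 * g.coeff 5 + f.coeff 2 * g.coeff 4 +
      f.coeff 3 * g.coeff 3 + f.coeff 4 * g.coeff 2 + f.coeff 5 * g.coeff 1 +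
      f.coeff 6 * g.coeff 0 := by
  simp [coeff_mul, Finset.Nat.antidiagonal_succ]
  ring

theorem coeff_mul_five (f g : ℂ[X]) :
    (f * g).coeff 5 = f.coeff 0 * g.coeff 5 + f.coeff 1 * g.coeff 4 + f.coeff 2 * g.coeff 3 +
      f.coeff 3 * g.coeff 2 + f.coeff 4 * g.coeff 1 + f.coeff 5 * g.coeff 0 := by
  simp [coeff_mul, Finset.Nat.antidiagonal_succ]
  ring

theorem coeff_mul_seven (f g : ℂ[X]) :
    (f * g).coeff 7 = f.coeff 0 * g.coeff 7 + f.coeff 1 * g.coeff 6 + f.coeff 2 * g.coeff 5 +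
      f.coeff 3 * g.coeff 4 + f.coeff 4 * g.coeff 3 + f.coeff 5 * g.coeff 2 +
      f.coeff 6 * g.coeff 1 + f.coeff 7 * g.coeff 0 := by
  simp [coeff_mul, Finset.Nat.antidiagonal_succ]
  ring

theorem coeff_mul_eight (f g : ℂ[X]) :
    (f * g).coeff 8 = f.coeff 0 * g.coeff 8 + f.coeff 1 * g.coeff 7 + f.coeff 2 * g.coeff 6 +
      f.coeff 3 * g.coeff 5 + f.coeff 4 * g.coeff 4 + f.coeff 5 * g.coeff 3 +
      f.coeff 6 * g.coeff 2 + f.coeff 7 * g.coeff 1 + f.coeff 8 * g.coeff 0 := by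
  simp [coeff_mul, Finset.Nat.antidiagonal_succ]
  ring

/-- Suppose that `F = p² q` and `F(x+1) - F(x) = c x ^ m` with `c ≠ 0`. The operator `G ↦ x G' - m
G` takes the same value `N` at `F(x)` and at `F(x+1)`, because it kills `x ^ m`. So `N` is
divisible by `p(x)` and by `p(x+1)`. These two can share only the root `0`, where `N` has at least
twice the larger of their multiplicities, so their product divides `N`. -/
theorem mul_comp_dvd_of_sq_mul {F p q : ℂ[X]} {m : ℕ} {c : ℂ} (hc : c ≠ 0) (hF : F = p ^ 2 * q)
    (hp : p ≠ 0) (hd : F.comp (X + 1) = F + C c * X ^ m) :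
    p.comp (X + 1) * p ∣ X * derivative F - C (m : ℂ) * F := by
  set U := F.comp (X + 1) with hU
  set A := p.comp (X + 1) with hA
  have hUA : U = A ^ 2 * q.comp (X + 1) := by rw [hU, hF]; simp [hA]
  have hA0 : A ≠ 0 := by
    intro h
    apply hp
    rw [hA, show (X + 1 : ℂ[X]) = X + C 1 by simp, ← taylor_apply] at h
    exact (taylor_eq_zero 1 p).mp h
  have hN : X * derivative F - C (m : ℂ) * F = X * derivative U - C (m : ℂ) * U := by
    rw [hd]
    simp only [derivative_add, derivative_C_mul, derivative_X_pow]
    rcases m with _ | m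
    · simp
    · simp only [Nat.add_sub_cancel, pow_succ]
      ring
  have key : ∀ {f G h : ℂ[X]}, G = f ^ 2 * h → f ∣ X * derivative G - C (m : ℂ) * G := by
    rintro f G h rfl
    refine ⟨X * (2 * derivative f * h + f * derivative h) - C (m : ℂ) * f * h, ?_⟩
    simp only [derivative_mul, derivative_sq]
    simp only [map_ofNat]
    ring
  have keyX : ∀ {s : ℕ} {G h : ℂ[X]}, G = X ^ s * h →
      X ^ s ∣ X * derivative G - C (m : ℂ) * G := by
    rintro s G h rfl
    refine ⟨C (s : ℂ) * h + X * derivative h - C (m : ℂ) * h, ?_⟩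
    rcases s with _ | s
    · simp
    · rw [derivative_mul, derivative_X_pow, Nat.add_sub_cancel, pow_succ]
      ring
  obtain ⟨A', hA', hXA⟩ := exists_eq_pow_rootMultiplicity_mul_and_not_dvd A hA0 0
  obtain ⟨B', hB', hXB⟩ := exists_eq_pow_rootMultiplicity_mul_and_not_dvd p hp 0
  set s := A.rootMultiplicity 0
  set t := p.rootMultiplicity 0
  simp only [C_0, sub_zero] at hA' hB' hXA hXB
  -- the power of `x`: use whichever of `F(x)`, `F(x+1)` vanishes more strongly at `0`
  have hXs : X ^ (s + t) ∣ X * derivative F - C (m : ℂ) * F := by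
    rcases le_total s t with h | h
    · refine (pow_dvd_pow X (show s + t ≤ 2 * t by omega)).trans
        (keyX (h := B' ^ 2 * q) ?_)
      rw [hF, hB']; ring
    · rw [hN]
      refine (pow_dvd_pow X (show s + t ≤ 2 * s by omega)).trans
        (keyX (h := A' ^ 2 * q.comp (X + 1)) ?_)
      rw [hUA, hA']; ring
  have hA'd : A' ∣ X * derivative F - C (m : ℂ) * F := by
    rw [hN]
    exact key (h := X ^ (2 * s) * q.comp (X + 1)) (by rw [hUA, hA']; ring)
  have hB'd : B' ∣ X * derivative F - C (m : ℂ) * F :=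
    key (h := X ^ (2 * t) * q) (by rw [hF, hB']; ring)
  have hcX : ∀ {f : ℂ[X]}, ¬ X ∣ f → ∀ k, IsCoprime (X ^ k) f := fun {f} hf k =>
    ((prime_X.irreducible.coprime_iff_not_dvd).mpr hf).pow_left
  have hcAB : IsCoprime A' B' := by
    apply isCoprime_of_dvd
    · rintro ⟨rfl, -⟩; exact hXA (dvd_zero _)
    · intro d hd1 hd0 hdA hdB
      obtain ⟨r, hr⟩ := IsAlgClosed.exists_root d (by
        intro hdeg
        exact hd1 (isUnit_iff_degree_eq_zero.mpr hdeg))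
      have hrA : A'.eval r = 0 := eval_eq_zero_of_dvd_of_eval_eq_zero hdA hr
      have hrB : B'.eval r = 0 := eval_eq_zero_of_dvd_of_eval_eq_zero hdB hr
      have hev := congrArg (eval r) hd
      rw [hUA, hF, hA', hB'] at hev
      simp only [eval_mul, eval_pow, eval_add, eval_C, eval_X, hrA, hrB] at hev
      have hr0 : r = 0 := by
        by_contra hr0
        have : c * r ^ m = 0 := by linear_combination -hev
        exact (mul_ne_zero hc (pow_ne_zero m hr0)) this
      subst hr0
      exact hXA (X_dvd_iff.mpr (by rw [coeff_zero_eq_eval_zero, hrA]))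
  have h1 := ((hcX hXA (s + t)).mul_right (hcX hXB (s + t))).mul_dvd hXs (hcAB.mul_dvd hA'd hB'd)
  have e : A * p = X ^ (s + t) * (A' * B') := by rw [hA', hB']; ring
  rw [e]
  exact h1

theorem reflect_bern_values (n : ℕ) (b : ℂ) (hn : 4 ≤ n) :
    (reflect n (bern n + C b)).coeff 0 = 1 ∧
    (reflect n (bern n + C b)).coeff 1 = -n / 2 ∧
    (reflect n (bern n + C b)).coeff 2 = n * (n - 1) / 12 ∧
    (reflect n (bern n + C b)).coeff 3 = 0 ∧
    (reflect n ((bern n).comp (X + 1) + C b)).coeff 0 = 1 ∧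
    (reflect n ((bern n).comp (X + 1) + C b)).coeff 1 = n / 2 ∧
    (reflect n ((bern n).comp (X + 1) + C b)).coeff 2 = n * (n - 1) / 12 ∧
    (reflect n ((bern n).comp (X + 1) + C b)).coeff 3 = 0 := by
  have h0 : ∀ j < n, (reflect n (bern n + C b)).coeff j =
      (n.choose j : ℂ) * ((_root_.bernoulli j : ℚ) : ℂ) := fun j hj => by
    have := coeff_reflect_bern_comp 0 b hj
    rwa [C_0, add_zero, comp_X, eval_bern_zero] at this
  have h1 : ∀ j < n, (reflect n ((bern n).comp (X + 1) + C b)).coeff j =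
      (n.choose j : ℂ) * (bern j).eval 1 := fun j hj => by
    have := coeff_reflect_bern_comp 1 b hj
    rwa [C_1] at this
  have hc := choose_values n
  rw [h0 0 (by omega), h0 1 (by omega), h0 2 (by omega), h0 3 (by omega), h1 0 (by omega),
    h1 1 (by omega), h1 2 (by omega), h1 3 (by omega), eval_bern_one_one,
    eval_bern_one (n := 0) (by norm_num), eval_bern_one (n := 2) (by norm_num),
    eval_bern_one (n := 3) (by norm_num), hc.1]
  simp only [bernoulli_three, _root_.bernoulli_zero, _root_.bernoulli_one,
    _root_.bernoulli_two, Nat.choose_zero_right, Nat.choose_one_right]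
  push_cast
  refine ⟨?_, ?_, ?_, ?_, ?_, ?_, ?_, ?_⟩ <;> ring

theorem reflect_bern_values_of_eight_le (n : ℕ) (b : ℂ) (hn : 8 ≤ n) :
    (reflect n (bern n + C b)).coeff 4 = -(n * (n - 1) * (n - 2) * (n - 3) / 720) ∧
    (reflect n (bern n + C b)).coeff 5 = 0 ∧
    (reflect n (bern n + C b)).coeff 6 =
      n * (n - 1) * (n - 2) * (n - 3) * (n - 4) * (n - 5) / 30240 ∧
    (reflect n (bern n + C b)).coeff 7 = 0 ∧
    (reflect n ((bern n).comp (X + 1) + C b)).coeff 4 =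
      -(n * (n - 1) * (n - 2) * (n - 3) / 720) ∧
    (reflect n ((bern n).comp (X + 1) + C b)).coeff 5 = 0 ∧
    (reflect n ((bern n).comp (X + 1) + C b)).coeff 6 =
      n * (n - 1) * (n - 2) * (n - 3) * (n - 4) * (n - 5) / 30240 ∧
    (reflect n ((bern n).comp (X + 1) + C b)).coeff 7 = 0 := by
  have h0 : ∀ j < n, (reflect n (bern n + C b)).coeff j =
      (n.choose j : ℂ) * ((_root_.bernoulli j : ℚ) : ℂ) := fun j hj => by
    have := coeff_reflect_bern_comp 0 b hj
    rwa [C_0, add_zero, comp_X, eval_bern_zero] at this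
  have h1 : ∀ j < n, j ≠ 1 → (reflect n ((bern n).comp (X + 1) + C b)).coeff j =
      (n.choose j : ℂ) * ((_root_.bernoulli j : ℚ) : ℂ) := fun j hj hj1 => by
    have := coeff_reflect_bern_comp 1 b hj
    rwa [C_1, eval_bern_one hj1] at this
  have hc := choose_values n
  rw [h0 4 (by omega), h0 5 (by omega), h0 6 (by omega), h0 7 (by omega), h1 4 (by omega)
    (by omega), h1 5 (by omega) (by omega), h1 6 (by omega) (by omega), h1 7 (by omega) (by omega),
    hc.2.1, hc.2.2]
  simp only [bernoulli_four, bernoulli_five, bernoulli_six, bernoulli_seven]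
  push_cast
  refine ⟨?_, ?_, ?_, ?_, ?_, ?_, ?_, ?_⟩ <;> ring

/-- `x F' - (n - 1) F` multiplies the `j`-th coefficient from the top by `1 - j`. -/
theorem coeff_reflect_X_mul_derivative_sub {F : ℂ[X]} {n j : ℕ} (hj : j < n) :
    (reflect n (X * derivative F - C ((n - 1 : ℕ) : ℂ) * F)).coeff j =
      (1 - j) * (reflect n F).coeff j := by
  rw [coeff_reflect, coeff_reflect, revAt_le (by omega), coeff_sub, coeff_C_mul]
  obtain ⟨i, rfl⟩ := Nat.exists_eq_add_of_lt hj
  rw [show j + i + 1 - j = i + 1 by omega, coeff_X_mul, coeff_derivative,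
    show j + i + 1 - 1 = j + i by omega]
  push_cast
  ring

/-- If `F = B_n + b` equals `p² q` with `q` monic, there is a monic `T` of the same degree as `q`
with `N² q(x) q(x+1) = T² F(x) F(x+1)`, where `N = x F' - (n - 1) F`. The degree of `T` is what
makes this a strong condition: `N` has degree `n` and is divisible by `p(x) p(x+1)`, of degree `n -
deg q`. The identity is stated for the reversed polynomials, so that coefficients are counted from
the top. -/
theorem exists_reflect_identity {n : ℕ} (hn : 1 ≤ n) {b : ℂ} {p q : ℂ[X]} (hp : p.Monic)
    (hq : q.Monic) (h : bern n + C b = p ^ 2 * q) :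
    ∃ T : ℂ[X], T.Monic ∧ T.natDegree = q.natDegree ∧
      reflect n (X * derivative (bern n + C b) - C ((n - 1 : ℕ) : ℂ) * (bern n + C b)) ^ 2 *
        (reflect q.natDegree (q.comp (X + 1)) * reflect q.natDegree q) =
      reflect q.natDegree T ^ 2 *
        (reflect n ((bern n).comp (X + 1) + C b) * reflect n (bern n + C b)) := by
  set F := bern n + C b with hF
  set N := X * derivative F - C ((n - 1 : ℕ) : ℂ) * F with hN
  have hn0 : (n : ℂ) ≠ 0 := by exact_mod_cast (show n ≠ 0 by omega)
  have hFc : F.comp (X + 1) = (bern n).comp (X + 1) + C b := by simp [hF]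
  have hd : F.comp (X + 1) = F + C (n : ℂ) * X ^ (n - 1) := by
    rw [hFc, bern_comp_add_one, hF]; simp; ring
  obtain ⟨T, hT⟩ := mul_comp_dvd_of_sq_mul hn0 h hp.ne_zero hd
  rw [← hN] at hT
  have hX1 : (X + 1 : ℂ[X]) = X + C 1 := by simp
  have hA : (p.comp (X + 1)).Monic := by rw [hX1]; exact hp.comp_X_add_C 1
  have hAdeg : (p.comp (X + 1)).natDegree = p.natDegree := by
    rw [hX1, natDegree_comp, natDegree_X_add_C, mul_one]
  have hFdeg : F.natDegree = n := by rw [hF, natDegree_add_C, natDegree_bern]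
  have hFm : F.Monic := by
    rw [hF]
    apply (monic_bern n).add_of_left
    refine lt_of_le_of_lt degree_C_le ?_
    rw [degree_eq_natDegree (monic_bern n).ne_zero, natDegree_bern]
    exact_mod_cast hn
  have hNle : N.natDegree ≤ n := by
    rw [natDegree_le_iff_coeff_eq_zero]
    intro i hi
    obtain ⟨i, rfl⟩ : ∃ i', i = i' + 1 := ⟨i - 1, by omega⟩
    have : F.coeff (i + 1) = 0 := coeff_eq_zero_of_natDegree_lt (by omega)
    rw [hN, coeff_sub, coeff_C_mul, coeff_X_mul, coeff_derivative, this]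
    ring
  have hN1 : N.coeff n = 1 := by
    have := coeff_reflect_X_mul_derivative_sub (F := F) (n := n) (j := 0) (by omega)
    rw [coeff_reflect, coeff_reflect, revAt_le (by omega), Nat.sub_zero] at this
    rw [hN, this, ← hFdeg, coeff_natDegree, hFm.leadingCoeff]
    simp
  have hNm : N.Monic := monic_of_natDegree_le_of_coeff_eq_one n hNle hN1
  have hNdeg : N.natDegree = n :=
    le_antisymm hNle (le_natDegree_of_ne_zero (by rw [hN1]; exact one_ne_zero))
  have hTm : T.Monic := (hA.mul hp).of_mul_monic_left (by rw [← hT]; exact hNm)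
  have hdeg1 : n = 2 * p.natDegree + q.natDegree := by
    rw [← hFdeg, h, (hp.pow 2).natDegree_mul hq, hp.natDegree_pow]
  have hdeg2 : n = p.natDegree + p.natDegree + T.natDegree := by
    rw [← hNdeg, hT, (hA.mul hp).natDegree_mul hTm, hA.natDegree_mul hp, hAdeg]
  have hTdeg : T.natDegree = q.natDegree := by omega
  refine ⟨T, hTm, hTdeg, ?_⟩
  have hqc : (q.comp (X + 1)).natDegree ≤ q.natDegree := by
    rw [hX1, natDegree_comp, natDegree_X_add_C, mul_one]
  have hUle : (F.comp (X + 1)).natDegree ≤ n := by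
    rw [hX1, natDegree_comp, natDegree_X_add_C, mul_one, hFdeg]
  have key : (N * N) * (q.comp (X + 1) * q) = (F.comp (X + 1) * F) * (T * T) := by
    have h2 : F.comp (X + 1) = p.comp (X + 1) ^ 2 * q.comp (X + 1) := by rw [h]; simp
    rw [h2, h, hT]; ring
  have key2 := congrArg (reflect ((n + n) + (q.natDegree + q.natDegree))) key
  rw [reflect_mul _ _ (natDegree_mul_le_of_le hNle hNle) (natDegree_mul_le_of_le hqc le_rfl),
    reflect_mul _ _ hNle hNle, reflect_mul _ _ hqc le_rfl,
    reflect_mul _ _ (natDegree_mul_le_of_le hUle hFdeg.le)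
      (natDegree_mul_le_of_le hTdeg.le hTdeg.le),
    reflect_mul _ _ hUle hFdeg.le, reflect_mul _ _ hTdeg.le hTdeg.le, hFc] at key2
  linear_combination key2

theorem coeff_mul_quartic (f : ℂ[X]) (a b c d : ℂ) :
    (f * (1 + C a * X + C b * X ^ 2 + C c * X ^ 3 + C d * X ^ 4)).coeff 1 =
      f.coeff 1 + a * f.coeff 0 ∧
    (f * (1 + C a * X + C b * X ^ 2 + C c * X ^ 3 + C d * X ^ 4)).coeff 2 =
      f.coeff 2 + a * f.coeff 1 + b * f.coeff 0 ∧
    (f * (1 + C a * X + C b * X ^ 2 + C c * X ^ 3 + C d * X ^ 4)).coeff 3 =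
      f.coeff 3 + a * f.coeff 2 + b * f.coeff 1 + c * f.coeff 0 ∧
    ∀ j, (f * (1 + C a * X + C b * X ^ 2 + C c * X ^ 3 + C d * X ^ 4)).coeff (j + 4) =
      f.coeff (j + 4) + a * f.coeff (j + 3) + b * f.coeff (j + 2) + c * f.coeff (j + 1) +
        d * f.coeff j := by
  have e : f * (1 + C a * X + C b * X ^ 2 + C c * X ^ 3 + C d * X ^ 4) =
      f + C a * (f * X ^ 1) + C b * (f * X ^ 2) + C c * (f * X ^ 3) + C d * (f * X ^ 4) := by ring
  rw [e]
  refine ⟨?_, ?_, ?_, fun j => ?_⟩ <;> simp [coeff_mul_X_pow']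

theorem reflect_linear (a : ℂ) : reflect 1 (X + C a) = 1 + C a * X := by
  have := reflect_monomial (R := ℂ) 1 1
  rw [pow_one, revAt_le le_rfl] at this
  rw [reflect_add, reflect_C, pow_one, this]
  simp

theorem reflect_quadratic (a b : ℂ) :
    reflect 2 (X ^ 2 + C a * X + C b) = 1 + C a * X + C b * X ^ 2 := by
  have h := reflect_C_mul_X_pow (R := ℂ) 2 1 (c := a)
  rw [pow_one, revAt_le (by norm_num)] at h
  rw [reflect_add, reflect_add, reflect_C, h, reflect_monomial, revAt_le le_rfl]
  simp

theorem eq_quadratic_of_monic {f : ℂ[X]} (hf : f.Monic) (hd : f.natDegree = 2) :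
    ∃ a b, f = X ^ 2 + C a * X + C b := ⟨f.coeff 1, f.coeff 0, by
  conv_lhs => rw [hf.as_sum, hd]
  simp [Finset.sum_range_succ]
  ring⟩

theorem eq_linear_of_monic {f : ℂ[X]} (hf : f.Monic) (hd : f.natDegree = 1) :
    ∃ a, f = X + C a := ⟨f.coeff 0, by
  conv_lhs => rw [hf.as_sum, hd]
  simp⟩

/-- Elimination of `c` and `t` from the coefficients of `u, u², u³` in
`(1 + M₂u + M₄u² + M₆u³) (1 + (2c - 1)u + c²u²) = (1 + P₂u + P₄u² + P₆u³) (1 + tu)²`. -/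
theorem eliminant_eq_zero {M2 M4 M6 P2 P4 P6 c t g A : ℂ} (hg : g = P2 - M2)
    (hA : A = P4 - M4 - M2 * g - (1 + g) ^ 2 / 4)
    (e2 : 2 * c - 1 + M2 = 2 * t + P2)
    (e4 : c ^ 2 + M2 * (2 * c - 1) + M4 = t ^ 2 + P2 * (2 * t) + P4)
    (e6 : M2 * c ^ 2 + M4 * (2 * c - 1) + M6 = P2 * t ^ 2 + P4 * (2 * t) + P6) :
    t * (1 - g) = A ∧
    -g * A ^ 2 + (M2 * (1 + g) + 2 * M4 - 2 * P4) * A * (1 - g) +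
      (M2 * (1 + g) ^ 2 / 4 + M4 * g + M6 - P6) * (1 - g) ^ 2 = 0 := by
  have hc : c = t + (1 + g) / 2 := by rw [hg]; linear_combination e2 / 2
  subst hc
  have hl : t * (1 - g) = A := by
    rw [hA]
    have : P2 = M2 + g := by rw [hg]; ring
    subst this
    linear_combination e4
  refine ⟨hl, ?_⟩
  have hP : P2 = M2 + g := by rw [hg]; ring
  subst hP
  linear_combination (1 - g) ^ 2 * e6 - (-g * (t * (1 - g) + A) +
    (M2 * (1 + g) + 2 * M4 - 2 * P4) * (1 - g)) * hl

/-- The eliminant vanishes at `10`, so the exponent `10` needs one more coefficient. With `n = 8 +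
m` all coefficients of the last factor are negative. -/
theorem eliminant_cast_ne_zero {n : ℕ} (hn : 8 ≤ n) (hn10 : n ≠ 10) :
    (n : ℂ) * (n - 2) * (n - 6) * (n - 10) * (590976 - 414432 * n - 95184 * n ^ 2 - 23408 * n ^ 3 +
      20512 * n ^ 4 - 1886 * n ^ 5 - 33 * n ^ 6) ≠ 0 := by
  obtain ⟨m, rfl⟩ := Nat.exists_eq_add_of_le hn
  have h1 : (((8 + m : ℕ) : ℂ) * ((8 + m : ℕ) - 2) * ((8 + m : ℕ) - 6)) ≠ 0 := by
    have : ((8 + m) * (6 + m) * (2 + m) : ℕ) ≠ 0 := by positivity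
    have h : (((8 + m) * (6 + m) * (2 + m) : ℕ) : ℂ) ≠ 0 := by exact_mod_cast this
    intro h0
    apply h
    rw [← h0]
    push_cast
    ring
  have h2 : (((8 + m : ℕ) : ℂ) - 10) ≠ 0 := by
    rw [sub_ne_zero]; exact_mod_cast hn10
  refine mul_ne_zero (mul_ne_zero h1 h2) ?_
  have h : ((7235200 + 9536480 * m + 4464208 * m ^ 2 + 911984 * m ^ 3 + 86608 * m ^ 4 +
      3470 * m ^ 5 + 33 * m ^ 6 : ℕ) : ℂ) ≠ 0 := by
    exact_mod_cast (by positivity)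
  intro h0
  apply h
  push_cast at h0 ⊢
  linear_combination -h0

/-- No polynomial `B_n + b` with `n ≥ 5`, `n ≠ 6` is of the form `p² q` with `q` monic of degree at
most `2`. -/
theorem bern_add_const_ne_sq_mul_monic {n : ℕ} (hn : 5 ≤ n) (hn6 : n ≠ 6) (b : ℂ) {p q : ℂ[X]}
    (hp : p.Monic) (hq : q.Monic) (hq2 : q.natDegree ≤ 2) : bern n + C b ≠ p ^ 2 * q := by
  intro h
  have hdeg : n = 2 * p.natDegree + q.natDegree := by
    rw [← hp.natDegree_pow, ← (hp.pow 2).natDegree_mul hq, ← h, natDegree_add_C, natDegree_bern]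
  obtain ⟨T, hT, hTdeg, hid⟩ := exists_reflect_identity (by omega) hp hq h
  obtain ⟨v0, v1, v2, v3, u0, u1, u2, u3⟩ := reflect_bern_values n b (by omega)
  have hN : ∀ j < n, _ := fun j hj =>
    coeff_reflect_X_mul_derivative_sub (F := bern n + C b) (n := n) hj
  have n0 := (hN 0 (by omega)).trans (show _ = (1 : ℂ) by rw [v0]; simp)
  have n1 := (hN 1 (by omega)).trans (show _ = (0 : ℂ) by simp)
  have n2 := (hN 2 (by omega)).trans
    (show _ = -((n : ℂ) * (n - 1) / 12) by rw [v2]; push_cast; ring)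
  have n3 := (hN 3 (by omega)).trans (show _ = (0 : ℂ) by rw [v3, mul_zero])
  have hval := reflect_bern_values_of_eight_le n b
  have h8 : n = 10 → (reflect n ((bern n).comp (X + 1) + C b)).coeff 8 = -3 / 2 ∧
      (reflect n (bern n + C b)).coeff 8 = -3 / 2 := by
    rintro rfl
    have h0 := coeff_reflect_bern_comp 0 b (show 8 < 10 by norm_num)
    have h1 := coeff_reflect_bern_comp 1 b (show 8 < 10 by norm_num)
    rw [C_1] at h1
    rw [C_0, add_zero, comp_X] at h0
    rw [h0, h1, eval_bern_one (by norm_num), eval_bern_zero, bernoulli_eight]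
    norm_num [Nat.choose]
  set N := reflect n (X * derivative (bern n + C b) - C ((n - 1 : ℕ) : ℂ) * (bern n + C b))
  set U := reflect n ((bern n).comp (X + 1) + C b)
  set V := reflect n (bern n + C b)
  -- the coefficients of `N²` and of `U V`
  obtain ⟨M0, M1, M2, M3, M4⟩ := coeff_mul_upto_four N N
  obtain ⟨P0, P1, P2, P3, P4⟩ := coeff_mul_upto_four U V
  rw [n0] at M0
  rw [n0, n1] at M1
  rw [n0, n1, n2] at M2
  rw [n0, n1, n2, n3] at M3
  rw [u0, v0] at P0
  rw [u0, v0, u1, v1] at P1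
  rw [u0, v0, u1, v1, u2, v2] at P2
  rw [u0, v0, u1, v1, u2, v2, u3, v3] at P3
  have hn5 : (n : ℂ) - 4 ≠ 0 := by
    rw [sub_ne_zero]; exact_mod_cast (show n ≠ 4 by omega)
  have hn3 : (n : ℂ) - 3 ≠ 0 := by
    rw [sub_ne_zero]; exact_mod_cast (show n ≠ 3 by omega)
  have hn1 : (n : ℂ) - 1 ≠ 0 := by
    rw [sub_ne_zero]; exact_mod_cast (show n ≠ 1 by omega)
  have hn0 : (n : ℂ) ≠ 0 := by exact_mod_cast (show n ≠ 0 by omega)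
  obtain hq0 | hq1 | hq2 : q.natDegree = 0 ∨ q.natDegree = 1 ∨ q.natDegree = 2 := by omega
  · have hq' : q = 1 := hq.natDegree_eq_zero.mp hq0
    have hT' : T = 1 := hT.natDegree_eq_zero.mp (by omega)
    have r1 : reflect 0 (1 : ℂ[X]) = 1 := by
      have := reflect_C (1 : ℂ) 0
      rwa [C_1, pow_zero, mul_one] at this
    rw [hq', hT', natDegree_one, one_comp, r1, one_pow, mul_one, mul_one, one_mul, pow_two] at hid
    have e2 := congrArg (fun f : ℂ[X] => f.coeff 2) hid
    rw [M2, P2] at e2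
    apply mul_ne_zero hn0 hn5
    linear_combination -12 * e2
  · obtain ⟨e, rfl⟩ := eq_linear_of_monic hq hq1
    obtain ⟨t, rfl⟩ := eq_linear_of_monic hT (hTdeg.trans hq1)
    rw [hq1, show (X + C e : ℂ[X]).comp (X + 1) = X + C (e + 1) by simp; ring,
      reflect_linear, reflect_linear, reflect_linear] at hid
    have hid' : N * N * (1 + C (2 * e + 1) * X + C (e * (e + 1)) * X ^ 2 + C 0 * X ^ 3 +
        C 0 * X ^ 4) =
        U * V * (1 + C (2 * t) * X + C (t ^ 2) * X ^ 2 + C 0 * X ^ 3 + C 0 * X ^ 4) := by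
      simp only [C_add, C_mul, C_1, C_0, C_pow, map_ofNat] at hid ⊢
      linear_combination hid
    have e1 := congrArg (fun f : ℂ[X] => f.coeff 1) hid'
    have e2 := congrArg (fun f : ℂ[X] => f.coeff 2) hid'
    have e3 := congrArg (fun f : ℂ[X] => f.coeff 3) hid'
    simp only [coeff_mul_quartic] at e1 e2 e3
    rw [M0, M1, P0, P1] at e1
    rw [M0, M1, P0, P1, M2, P2] at e2
    rw [M0, M1, P0, P1, M2, P2, M3, P3] at e3
    have : t = e + 1 / 2 := by linear_combination - e1 / 2
    subst this
    -- the second coefficient is `(n - 1) (n - 3) / 12`, whatever the root of `q` is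
    apply mul_ne_zero hn1 hn3
    linear_combination -12 * e2
  · obtain ⟨s', c, rfl⟩ := eq_quadratic_of_monic hq hq2
    obtain ⟨s, rfl⟩ : ∃ s, s' = s - 1 := ⟨s' + 1, by ring⟩
    obtain ⟨t1, t, rfl⟩ := eq_quadratic_of_monic hT (hTdeg.trans hq2)
    rw [hq2] at hid hdeg
    have hn8 : 8 ≤ n := by omega
    obtain ⟨v4, v5, v6, v7, u4, u5, u6, u7⟩ := hval hn8
    have n4 := (hN 4 (by omega)).trans
      (show _ = (n : ℂ) * (n - 1) * (n - 2) * (n - 3) / 240 by rw [v4]; push_cast; ring)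
    have n5 := (hN 5 (by omega)).trans (show _ = (0 : ℂ) by rw [v5, mul_zero])
    have n6 := (hN 6 (by omega)).trans
      (show _ = -((n : ℂ) * (n - 1) * (n - 2) * (n - 3) * (n - 4) * (n - 5) / 6048) by
        rw [v6]; push_cast; ring)
    have n7 := (hN 7 (by omega)).trans (show _ = (0 : ℂ) by rw [v7, mul_zero])
    have M5 := coeff_mul_five N N
    have M6 := coeff_mul_six N N
    have M7 := coeff_mul_seven N N
    have P5 := coeff_mul_five U V
    have P6 := coeff_mul_six U V
    have P7 := coeff_mul_seven U V
    rw [n0, n1, n2, n3, n4] at M4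
    rw [n0, n1, n2, n3, n4, n5] at M5
    rw [n0, n1, n2, n3, n4, n5, n6] at M6
    rw [n0, n1, n2, n3, n4, n5, n6, n7] at M7
    rw [u0, u1, u2, u3, u4, v0, v1, v2, v3, v4] at P4
    rw [u0, u1, u2, u3, u4, u5, v0, v1, v2, v3, v4, v5] at P5
    rw [u0, u1, u2, u3, u4, u5, u6, v0, v1, v2, v3, v4, v5, v6] at P6
    rw [u0, u1, u2, u3, u4, u5, u6, u7, v0, v1, v2, v3, v4, v5, v6, v7] at P7
    rw [show (X ^ 2 + C (s - 1) * X + C c : ℂ[X]).comp (X + 1) =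
        X ^ 2 + C (s + 1) * X + C (s + c) by simp; ring,
      reflect_quadratic, reflect_quadratic, reflect_quadratic] at hid
    have hid' : N * N * (1 + C (2 * s) * X + C (s ^ 2 - 1 + s + 2 * c) * X ^ 2 +
        C ((s - 1) * (s + c) + c * (s + 1)) * X ^ 3 + C (c * (s + c)) * X ^ 4) =
        U * V * (1 + C (2 * t1) * X + C (t1 ^ 2 + 2 * t) * X ^ 2 + C (2 * t1 * t) * X ^ 3 +
          C (t ^ 2) * X ^ 4) := by
      simp only [C_add, C_mul, C_1, C_pow, C_sub, map_ofNat] at hid ⊢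
      linear_combination hid
    have e1 := congrArg (fun f : ℂ[X] => f.coeff 1) hid'
    have e2 := congrArg (fun f : ℂ[X] => f.coeff 2) hid'
    have e3 := congrArg (fun f : ℂ[X] => f.coeff 3) hid'
    have e4 := congrArg (fun f : ℂ[X] => f.coeff (0 + 4)) hid'
    have e6 := congrArg (fun f : ℂ[X] => f.coeff (2 + 4)) hid'
    have e8 := congrArg (fun f : ℂ[X] => f.coeff (4 + 4)) hid'
    simp only [coeff_mul_quartic] at e1 e2 e3 e4 e6 e8
    norm_num only at e4 e6 e8
    rw [M0, M1, P0, P1] at e1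
    rw [M0, M1, P0, P1, M2, P2] at e2
    rw [M0, M1, P0, P1, M2, P2, M3, P3] at e3
    have ht1 : t1 = s := by linear_combination -e1 / 2
    subst ht1
    -- comparing the second and third coefficients centres `q` at `1/2`
    have hs : t1 = 0 := by
      have : t1 * (n * (n - 4)) = 0 := by linear_combination 12 * t1 * e2 - 12 * e3
      exact (mul_eq_zero.mp this).resolve_right (mul_ne_zero hn0 hn5)
    subst hs
    set m2 := (N * N).coeff 2
    set m4 := (N * N).coeff 4
    set m6 := (N * N).coeff 6
    set p2 := (U * V).coeff 2
    set p4 := (U * V).coeff 4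
    set p6 := (U * V).coeff 6
    rw [M0, M1, M3, P0, P1, P3] at e4
    rw [M3, M5, P3, P5] at e6
    rw [M5, M7, P5, P7] at e8
    obtain ⟨hlin, hel⟩ := eliminant_eq_zero (M2 := m2) (M4 := m4) (M6 := m6) (P2 := p2) (P4 := p4)
      (P6 := p6) (c := c) (t := t) rfl rfl (by rw [M2, P2]; linear_combination e2)
      (by linear_combination e4) (by linear_combination e6)
    by_cases hn10 : n = 10
    · -- the eliminant vanishes here, and the eighth coefficient gives the contradiction
      obtain ⟨u8, v8⟩ := h8 hn10
      have n8 := (hN 8 (by omega)).trans (show _ = (21 / 2 : ℂ) by rw [v8]; push_cast; norm_num)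
      have M8 := coeff_mul_eight N N
      have P8 := coeff_mul_eight U V
      rw [n0, n1, n2, n3, n4, n5, n6, n7, n8] at M8
      rw [u0, u1, u2, u3, u4, u5, u6, u7, u8, v0, v1, v2, v3, v4, v5, v6, v7, v8] at P8
      have hn10' : (n : ℂ) = 10 := by exact_mod_cast hn10
      rw [hn10'] at M2 M4 M6 M8 P2 P4 P6 P8 e2
      rw [M2, M4, P2, P4] at hlin
      rw [M4, M6, M8, P4, P6, P8] at e8
      norm_num at hlin e8 e2
      have ht : t = -5 / 2 := by linear_combination -hlin / 4
      have hc : c = 1 / 2 := by linear_combination e2 / 2 + ht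
      rw [ht, hc] at e8
      norm_num at e8
    · apply eliminant_cast_ne_zero hn8 hn10
      rw [M2, M4, M6, P2, P4, P6] at hel
      linear_combination -696729600 * hel

/-- No polynomial `B_n + b` with `n ≥ 5`, `n ≠ 6` is of the form `p² q` with `deg q ≤ 2`: it has at
least three roots of odd multiplicity. -/
theorem bern_add_const_ne_sq_mul {n : ℕ} (hn : 5 ≤ n) (hn6 : n ≠ 6) (b : ℂ) {p q : ℂ[X]}
    (hq2 : q.natDegree ≤ 2) : bern n + C b ≠ p ^ 2 * q := by
  intro h
  have hlead : (bern n + C b).leadingCoeff = 1 := by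
    rw [leadingCoeff, natDegree_add_C, natDegree_bern, coeff_add, coeff_C_of_ne_zero (by omega),
      add_zero]
    have := monic_bern n
    rwa [Monic, leadingCoeff, natDegree_bern] at this
  have hmul : p.leadingCoeff ^ 2 * q.leadingCoeff = 1 := by
    rw [← hlead, h, leadingCoeff_mul, leadingCoeff_pow]
  have hp0 : p.leadingCoeff ≠ 0 := by
    intro h0; rw [h0] at hmul; simp at hmul
  refine bern_add_const_ne_sq_mul_monic hn hn6 b (p := C p.leadingCoeff⁻¹ * p)
    (q := C (p.leadingCoeff ^ 2) * q) ?_ ?_ (natDegree_C_mul_le _ _ |>.trans hq2) ?_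
  · rw [Monic, leadingCoeff_mul, leadingCoeff_C, inv_mul_cancel₀ hp0]
  · rw [Monic, leadingCoeff_mul, leadingCoeff_C, hmul]
  · rw [h]
    have : (C p.leadingCoeff⁻¹ * C p.leadingCoeff : ℂ[X]) = 1 := by
      rw [← C_mul, inv_mul_cancel₀ hp0, C_1]
    rw [C_pow]
    linear_combination -(p ^ 2 * q * (C p.leadingCoeff⁻¹ * C p.leadingCoeff + 1)) * this

/-! ### Decompositions of Bernoulli polynomials -/

theorem eq_C_of_comp_add_one_eq {f : ℂ[X]} (h : f.comp (X + 1) = f) : f = C (f.eval 0) := by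
  have hm : ∀ m : ℕ, f.eval (m : ℂ) = f.eval 0 := by
    intro m
    induction m with
    | zero => simp
    | succ m ih =>
      rw [← ih]
      conv_rhs => rw [← h]
      simp [eval_comp]
  apply eq_of_infinite_eval_eq
  apply (Set.infinite_range_of_injective (Nat.cast_injective (R := ℂ))).mono
  rintro _ ⟨m, rfl⟩
  simp [hm m]

/-- A right composition factor of a Bernoulli polynomial is itself affinely equivalent to a
Bernoulli polynomial: its forward difference divides a power of `x`. -/
theorem eq_bern_of_bern_eq_comp {n : ℕ} (hn : n ≠ 0) {f g : ℂ[X]} (h : bern n = f.comp g) :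
    ∃ u v : ℂ, u ≠ 0 ∧ g = C u * bern g.natDegree + C v := by
  have hD : g.comp (X + 1) - g ∣ X ^ (n - 1) := by
    have h1 := sub_dvd_eval_sub (g.comp (X + 1)) g (f.map C)
    rw [eval_map, eval_map] at h1
    change _ ∣ f.comp (g.comp (X + 1)) - f.comp g at h1
    rw [← comp_assoc, ← h, bern_comp_add_one, add_sub_cancel_left] at h1
    have hu : IsUnit (n : ℂ[X]) := by
      rw [← C_eq_natCast]
      exact isUnit_C.mpr (isUnit_iff_ne_zero.mpr (by exact_mod_cast hn))
    exact (hu.dvd_mul_left).mp h1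
  obtain ⟨i, -, hi⟩ := (dvd_prime_pow prime_X _).mp hD
  obtain ⟨w, hw⟩ := hi.symm
  obtain ⟨c, hc, hcw⟩ := isUnit_iff.mp w.isUnit
  rw [← hcw] at hw
  have hc0 : c ≠ 0 := hc.ne_zero
  have hi0 : ((i : ℂ) + 1) ≠ 0 := by exact_mod_cast Nat.succ_ne_zero i
  set r := g - C (c / (i + 1)) * bern (i + 1) with hr
  have hper : r.comp (X + 1) = r := by
    have e1 : g.comp (X + 1) = g + X ^ i * C c := by rw [hw]; ring
    have e2 : (C (c / (i + 1)) : ℂ[X]) * ((i : ℂ[X]) + 1) = C c := by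
      rw [← C_eq_natCast, ← C_1, ← C_add, ← C_mul, div_mul_cancel₀ _ hi0]
    rw [hr, sub_comp, mul_comp, C_comp, bern_comp_add_one, e1, Nat.add_sub_cancel]
    push_cast
    linear_combination -X ^ i * e2
  have hg' : g = C (c / (i + 1)) * bern (i + 1) + C (r.eval 0) := by
    rw [← eq_C_of_comp_add_one_eq hper, hr]; ring
  have hne : c / (i + 1) ≠ 0 := div_ne_zero hc0 hi0
  have hdeg : g.natDegree = i + 1 := by
    rw [hg', natDegree_add_C, natDegree_C_mul hne, natDegree_bern]
  exact ⟨_, _, hne, by rw [hdeg]; exact hg'⟩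

/-- The three top coefficients of `f ^ t`, for `f` with top coefficients `1, a, b`. -/
theorem reflect_pow_values {f : ℂ[X]} {d : ℕ} (hd : f.natDegree ≤ d) {a b : ℂ}
    (h0 : (reflect d f).coeff 0 = 1) (h1 : (reflect d f).coeff 1 = a)
    (h2 : (reflect d f).coeff 2 = b) (t : ℕ) :
    (reflect (t * d) (f ^ t)).coeff 0 = 1 ∧ (reflect (t * d) (f ^ t)).coeff 1 = t * a ∧
      (reflect (t * d) (f ^ t)).coeff 2 = t * b + t * (t - 1) / 2 * a ^ 2 := by
  induction t with
  | zero =>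
    have := reflect_C (1 : ℂ) 0
    rw [C_1, pow_zero, mul_one] at this
    simp [this, coeff_one]
  | succ t ih =>
    obtain ⟨i0, i1, i2⟩ := ih
    rw [pow_succ, add_mul, one_mul, reflect_mul _ _ (natDegree_pow_le_of_le t hd) hd]
    obtain ⟨c0, c1, c2, -, -⟩ := coeff_mul_upto_four (reflect (t * d) (f ^ t)) (reflect d f)
    rw [c0, c1, c2, i0, i1, i2, h0, h1, h2]
    push_cast
    refine ⟨?_, ?_, ?_⟩ <;> ring

theorem reflect_bern_low {n : ℕ} (hn : 3 ≤ n) :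
    (reflect n (bern n)).coeff 0 = 1 ∧ (reflect n (bern n)).coeff 1 = -n / 2 ∧
      (reflect n (bern n)).coeff 2 = n * (n - 1) / 12 := by
  have h0 : ∀ j < n, (reflect n (bern n)).coeff j =
      (n.choose j : ℂ) * ((_root_.bernoulli j : ℚ) : ℂ) := fun j hj => by
    have := coeff_reflect_bern_comp 0 0 hj
    rwa [C_0, add_zero, add_zero, comp_X, eval_bern_zero] at this
  rw [h0 0 (by omega), h0 1 (by omega), h0 2 (by omega), (choose_values n).1]
  simp only [_root_.bernoulli_zero, _root_.bernoulli_one,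
    _root_.bernoulli_two, Nat.choose_zero_right, Nat.choose_one_right]
  push_cast
  refine ⟨?_, ?_, ?_⟩ <;> ring

/-- The coefficient of `x ^ (n - 2)` shows that `B_n` is not a polynomial in `B_d` for `3 ≤ d < n`.
-/
theorem bern_ne_comp_bern {n d : ℕ} (hd : 3 ≤ d) {f : ℂ[X]} (hf : 2 ≤ f.natDegree) :
    bern n ≠ f.comp (bern d) := by
  intro h
  set t := f.natDegree with ht
  have hn : n = t * d := by
    have := congrArg natDegree h
    rwa [natDegree_comp, natDegree_bern, natDegree_bern] at this
  have hd' : (bern d).natDegree ≤ d := (natDegree_bern d).le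
  -- the terms of `f` below the leading one do not reach the three top coefficients
  have hsplit : bern n = C f.leadingCoeff * bern d ^ t + f.eraseLead.comp (bern d) := by
    have := congrArg (fun r : ℂ[X] => r.comp (bern d)) (eraseLead_add_C_mul_X_pow f)
    simp only [add_comp, mul_comp, C_comp, X_pow_comp] at this
    rw [h, ← this, add_comm]
  have hlow : ∀ j < 3, (reflect n (f.eraseLead.comp (bern d))).coeff j = 0 := by
    intro j hj
    obtain ⟨t', ht'⟩ : ∃ t', t = t' + 1 := ⟨t - 1, by omega⟩
    have hnd : n = t' * d + d := by rw [hn, ht', add_mul, one_mul]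
    rw [coeff_reflect, revAt_le (by omega)]
    apply coeff_eq_zero_of_natDegree_lt
    rw [natDegree_comp, natDegree_bern]
    have : f.eraseLead.natDegree * d ≤ t' * d :=
      Nat.mul_le_mul_right d ((eraseLead_natDegree_le f).trans (by omega))
    omega
  have hc : ∀ j < 3, (reflect n (bern n)).coeff j =
      f.leadingCoeff * (reflect (t * d) (bern d ^ t)).coeff j := by
    intro j hj
    conv_lhs => rw [hsplit]
    rw [reflect_add, coeff_add, hlow j hj, add_zero, reflect_C_mul, coeff_C_mul, hn]
  obtain ⟨b0, b1, b2⟩ := reflect_bern_low hd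
  obtain ⟨p0, p1, p2⟩ := reflect_pow_values hd' b0 b1 b2 t
  have hdn : d ≤ n := by rw [hn]; exact Nat.le_mul_of_pos_left d (by omega)
  obtain ⟨a0, a1, a2⟩ := reflect_bern_low (hd.trans hdn)
  have c0 := hc 0 (by norm_num)
  have c2 := hc 2 (by norm_num)
  rw [a0, p0, mul_one] at c0
  rw [a2, p2, ← c0, hn] at c2
  push_cast at c2
  have hd0 : (d : ℂ) ≠ 0 := by exact_mod_cast (show d ≠ 0 by omega)
  have ht0 : (t : ℂ) ≠ 0 := by exact_mod_cast (show t ≠ 0 by omega)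
  have ht1 : (t : ℂ) - 1 ≠ 0 := by
    rw [sub_ne_zero]; exact_mod_cast (show t ≠ 1 by omega)
  apply mul_ne_zero (mul_ne_zero (pow_ne_zero 2 hd0) ht0) ht1
  linear_combination -24 * c2

/-- Decompositions of Bernoulli polynomials: a right factor of degree at least `2` of a nontrivial
decomposition is, up to an affine change of variable, `(x - 1/2)²`. -/
theorem eq_sq_of_bern_eq_comp {n : ℕ} {f g : ℂ[X]} (h : bern n = f.comp g)
    (hf : 2 ≤ f.natDegree) (hg : 2 ≤ g.natDegree) :
    ∃ u v : ℂ, u ≠ 0 ∧ g = C u * (X - C (1 / 2)) ^ 2 + C v := by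
  have hn : n ≠ 0 := by
    have := congrArg natDegree h
    rw [natDegree_comp, natDegree_bern] at this
    rw [this]
    positivity
  obtain ⟨u, v, hu, huv⟩ := eq_bern_of_bern_eq_comp hn h
  rcases hg.eq_or_lt with h2 | h3
  · have hb : bern 2 = X ^ 2 + C (-1) * X + C (1 / 6) := by
      rw [(monic_bern 2).as_sum, natDegree_bern]
      simp only [Finset.sum_range_succ, Finset.sum_range_zero, bern, coeff_map,
        Polynomial.coeff_bernoulli]
      norm_num [_root_.bernoulli_two, _root_.bernoulli_one]
      ring
    refine ⟨u, v - u / 12, hu, ?_⟩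
    rw [huv, ← h2, hb]
    have e1 : (C (1 / 6) : ℂ[X]) = C (1 / 2) ^ 2 - C (1 / 12) := by
      rw [← C_pow, ← C_sub]; norm_num
    have e2 : (2 : ℂ[X]) * C (1 / 2) = 1 := by
      rw [← map_ofNat C 2, ← C_mul]; norm_num
    rw [e1, show v - u / 12 = v - u * (1 / 12) by ring, C_sub, C_mul, C_neg, C_1]
    linear_combination C u * X * e2
  · exfalso
    refine bern_ne_comp_bern (n := n) (d := g.natDegree) h3 (f := f.comp (C u * X + C v)) ?_ ?_
    · rw [natDegree_comp, natDegree_linear hu, mul_one]; exact hf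
    · rw [comp_assoc]
      have : (C u * X + C v : ℂ[X]).comp (bern g.natDegree) = g := by
        conv_rhs => rw [huv]
        simp
      rw [this, h]

/-! ### Newton identities and power sums -/

/-- Newton's identities: the top coefficients of `∏ (x - ρ_i)` in terms of power sums. -/
theorem reflect_prod_values (ρ : ℕ → ℂ) (t : ℕ) :
    (reflect t (∏ i ∈ Finset.range t, (X - C (ρ i)))).coeff 0 = 1 ∧
    (reflect t (∏ i ∈ Finset.range t, (X - C (ρ i)))).coeff 1 = -∑ i ∈ Finset.range t, ρ i ∧
    2 * (reflect t (∏ i ∈ Finset.range t, (X - C (ρ i)))).coeff 2 =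
      (∑ i ∈ Finset.range t, ρ i) ^ 2 - ∑ i ∈ Finset.range t, ρ i ^ 2 ∧
    6 * (reflect t (∏ i ∈ Finset.range t, (X - C (ρ i)))).coeff 3 =
      -((∑ i ∈ Finset.range t, ρ i) ^ 3 -
        3 * (∑ i ∈ Finset.range t, ρ i) * (∑ i ∈ Finset.range t, ρ i ^ 2) +
        2 * ∑ i ∈ Finset.range t, ρ i ^ 3) ∧
    24 * (reflect t (∏ i ∈ Finset.range t, (X - C (ρ i)))).coeff 4 =
      (∑ i ∈ Finset.range t, ρ i) ^ 4 -
        6 * (∑ i ∈ Finset.range t, ρ i) ^ 2 * (∑ i ∈ Finset.range t, ρ i ^ 2) +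
        3 * (∑ i ∈ Finset.range t, ρ i ^ 2) ^ 2 +
        8 * (∑ i ∈ Finset.range t, ρ i) * (∑ i ∈ Finset.range t, ρ i ^ 3) -
        6 * ∑ i ∈ Finset.range t, ρ i ^ 4 := by
  induction t with
  | zero =>
    have := reflect_C (1 : ℂ) 0
    rw [C_1, pow_zero, mul_one] at this
    simp [this, coeff_one]
  | succ t ih =>
    have hdeg : (∏ i ∈ Finset.range t, (X - C (ρ i))).natDegree ≤ t := by
      refine (natDegree_prod_le _ _).trans ?_
      simp
    have hl : reflect 1 (X - C (ρ t)) = 1 + C (-ρ t) * X := by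
      rw [← reflect_linear, C_neg, sub_eq_add_neg]
    obtain ⟨i0, i1, i2, i3, i4⟩ := ih
    set P := reflect t (∏ i ∈ Finset.range t, (X - C (ρ i)))
    have hmul : reflect (t + 1) (∏ i ∈ Finset.range (t + 1), (X - C (ρ i))) =
        P * (1 + C (-ρ t) * X + C 0 * X ^ 2 + C 0 * X ^ 3 + C 0 * X ^ 4) := by
      rw [Finset.prod_range_succ, reflect_mul _ _ hdeg (natDegree_X_sub_C_le _), hl, C_0]
      ring
    have c0 : (P * (1 + C (-ρ t) * X + C 0 * X ^ 2 + C 0 * X ^ 3 + C 0 * X ^ 4)).coeff 0 =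
        P.coeff 0 := by rw [mul_coeff_zero]; simp
    obtain ⟨c1, c2, c3, c4⟩ := coeff_mul_quartic P (-ρ t) 0 0 0
    have c4 := c4 0
    norm_num only at c4
    rw [hmul, c0, c1, c2, c3, c4]
    simp only [Finset.sum_range_succ]
    refine ⟨i0, ?_, ?_, ?_, ?_⟩
    · linear_combination i1 - ρ t * i0
    · linear_combination i2 - 2 * ρ t * i1
    · linear_combination i3 - 3 * ρ t * i2
    · linear_combination i4 - 4 * ρ t * i3

/-- Power sums of `n` numbers that are the roots of `B_n(x + 1/2) + β`. -/
theorem power_sums_of_bern_eq_prod {n : ℕ} {β : ℂ} {σ : ℕ → ℂ} (hn : 3 ≤ n)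
    (h : (bern n).comp (X + C (1 / 2)) + C β = ∏ i ∈ Finset.range n, (X - C (σ i))) :
    ∑ i ∈ Finset.range n, σ i = 0 ∧ ∑ i ∈ Finset.range n, σ i ^ 2 = n * (n - 1) / 12 ∧
    (4 ≤ n → ∑ i ∈ Finset.range n, σ i ^ 3 = 0) ∧
    (5 ≤ n → 6 * ∑ i ∈ Finset.range n, σ i ^ 4 = 3 * (n * (n - 1) / 12 : ℂ) ^ 2 -
      7 / 240 * (n * (n - 1) * (n - 2) * (n - 3))) := by
  obtain ⟨-, c1, c2, c3, c4⟩ := reflect_prod_values σ n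
  rw [← h] at c1 c2 c3 c4
  obtain ⟨-, b1, b2, b3, b4, -⟩ := bern_half_values
  obtain ⟨k2, k4, -⟩ := choose_values n
  rw [coeff_reflect_bern_comp _ _ (by omega), b1, mul_zero] at c1
  rw [coeff_reflect_bern_comp _ _ (by omega), b2, k2] at c2
  have s1 : ∑ i ∈ Finset.range n, σ i = 0 := by linear_combination c1
  have s2 : ∑ i ∈ Finset.range n, σ i ^ 2 = n * (n - 1) / 12 := by
    rw [s1] at c2
    linear_combination c2
  have s3 : 4 ≤ n → ∑ i ∈ Finset.range n, σ i ^ 3 = 0 := fun h4 => by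
    rw [coeff_reflect_bern_comp _ _ (by omega), b3, s1] at c3
    linear_combination c3 / 2
  refine ⟨s1, s2, s3, fun h5 => ?_⟩
  rw [coeff_reflect_bern_comp _ _ (by omega), b4, k4, s1, s2] at c4
  linear_combination c4

/-- Second and third central moments of the numbers `σ_i` when `∏ (x² - σ_i)` equals
`B_{2t}(x + 1/2)` up to an additive constant. -/
theorem power_sums_of_bern_eq_prod_sq {t : ℕ} {β : ℂ} {σ : ℕ → ℂ} (ht : 4 ≤ t)
    (h : (bern (2 * t)).comp (X + C (1 / 2)) + C β =
      ∏ i ∈ Finset.range t, (X ^ 2 - C (σ i))) :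
    t * (∑ i ∈ Finset.range t, σ i ^ 2) - (∑ i ∈ Finset.range t, σ i) ^ 2 =
      -(t ^ 2 * (2 * t - 1) * (t - 1) * (t - 4) / 180) ∧
    t ^ 2 * (∑ i ∈ Finset.range t, σ i ^ 3) -
      3 * t * (∑ i ∈ Finset.range t, σ i) * (∑ i ∈ Finset.range t, σ i ^ 2) +
      2 * (∑ i ∈ Finset.range t, σ i) ^ 3 =
      t ^ 3 * (2 * t - 1) * (t - 1) * (t - 2) * (4 * t ^ 2 - 37 * t + 64) / 7560 := by
  obtain ⟨-, c1, c2, c3, -⟩ := reflect_prod_values σ t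
  have hexp : expand ℂ 2 (∏ i ∈ Finset.range t, (X - C (σ i))) =
      ∏ i ∈ Finset.range t, (X ^ 2 - C (σ i)) := by
    rw [map_prod]
    simp [expand_X, expand_C]
  rw [← hexp] at h
  have hco : ∀ j < t, (reflect t (∏ i ∈ Finset.range t, (X - C (σ i)))).coeff j =
      ((2 * t).choose (2 * j) : ℂ) * (bern (2 * j)).eval (1 / 2) := by
    intro j hj
    rw [← coeff_reflect_bern_comp (1 / 2) β (by omega), h, coeff_reflect, coeff_reflect,
      revAt_le (by omega), revAt_le (by omega), ← Nat.mul_sub, mul_comm 2, coeff_expand_mul]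
    norm_num
  obtain ⟨k2, k4, k6⟩ := choose_values (2 * t)
  obtain ⟨-, -, b2, -, b4, b6⟩ := bern_half_values
  rw [hco 1 (by omega)] at c1
  rw [hco 2 (by omega)] at c2
  rw [hco 3 (by omega)] at c3
  norm_num only at c1 c2 c3
  norm_num only at b2 b4 b6
  rw [b2, k2] at c1
  rw [b4, k4] at c2
  rw [b6, k6] at c3
  push_cast at c1 c2 c3
  set s1 := ∑ i ∈ Finset.range t, σ i
  set s2 := ∑ i ∈ Finset.range t, σ i ^ 2
  set s3 := ∑ i ∈ Finset.range t, σ i ^ 3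
  clear_value s1 s2 s3
  obtain rfl : s1 = t * (2 * t - 1) / 12 := by linear_combination c1
  have e2 : s2 = (t * (2 * t - 1) / 12 : ℂ) ^ 2 -
      7 / 2880 * (2 * t * (2 * t - 1) * (2 * t - 2) * (2 * t - 3)) := by
    linear_combination c2
  subst e2
  refine ⟨by ring, ?_⟩
  linear_combination t ^ 2 / 2 * c3

theorem sum_range_linear (u v : ℂ) (t : ℕ) :
    ∑ i ∈ Finset.range t, (u + v * i) = t * u + v * (t * (t - 1) / 2) ∧
    ∑ i ∈ Finset.range t, (u + v * i) ^ 2 =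
      t * u ^ 2 + u * v * (t * (t - 1)) + v ^ 2 * (t * (t - 1) * (2 * t - 1) / 6) ∧
    ∑ i ∈ Finset.range t, (u + v * i) ^ 3 =
      t * u ^ 3 + 3 * u ^ 2 * v * (t * (t - 1) / 2) +
        3 * u * v ^ 2 * (t * (t - 1) * (2 * t - 1) / 6) + v ^ 3 * (t * (t - 1) / 2) ^ 2 ∧
    ∑ i ∈ Finset.range t, (u + v * i) ^ 4 =
      t * u ^ 4 + 4 * u ^ 3 * v * (t * (t - 1) / 2) +
        6 * u ^ 2 * v ^ 2 * (t * (t - 1) * (2 * t - 1) / 6) +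
        4 * u * v ^ 3 * (t * (t - 1) / 2) ^ 2 +
        v ^ 4 * (t * (t - 1) * (2 * t - 1) * (3 * t ^ 2 - 3 * t - 1) / 30) := by
  induction t with
  | zero => simp
  | succ t ih =>
    obtain ⟨i1, i2, i3, i4⟩ := ih
    simp only [Finset.sum_range_succ, i1, i2, i3, i4]
    push_cast
    refine ⟨?_, ?_, ?_, ?_⟩ <;> ring

theorem sum_range_odd_sq (u v : ℂ) (t : ℕ) :
    ∑ i ∈ Finset.range t, (u + v * (2 * i + 1) ^ 2) = t * u + v * (t * (4 * t ^ 2 - 1) / 3) ∧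
    ∑ i ∈ Finset.range t, (u + v * (2 * i + 1) ^ 2) ^ 2 =
      t * u ^ 2 + 2 * u * v * (t * (4 * t ^ 2 - 1) / 3) +
        v ^ 2 * (t * (48 * t ^ 4 - 40 * t ^ 2 + 7) / 15) ∧
    ∑ i ∈ Finset.range t, (u + v * (2 * i + 1) ^ 2) ^ 3 =
      t * u ^ 3 + 3 * u ^ 2 * v * (t * (4 * t ^ 2 - 1) / 3) +
        3 * u * v ^ 2 * (t * (48 * t ^ 4 - 40 * t ^ 2 + 7) / 15) +
        v ^ 3 * (t * (192 * t ^ 6 - 336 * t ^ 4 + 196 * t ^ 2 - 31) / 21) := by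
  induction t with
  | zero => simp
  | succ t ih =>
    obtain ⟨i1, i2, i3⟩ := ih
    simp only [Finset.sum_range_succ, i1, i2, i3]
    push_cast
    refine ⟨?_, ?_, ?_⟩ <;> ring

/-! ### Comparison with progressions and with odd squares -/

/-- The roots of `B_n + b` do not form an arithmetic progression for `n ≥ 5`: their first two power
sums would determine the progression, and its fourth power sum is wrong. -/
theorem bern_ne_prod_linear {n : ℕ} (hn : 5 ≤ n) (u v β : ℂ) :
    (bern n).comp (X + C (1 / 2)) + C β ≠ ∏ i ∈ Finset.range n, (X - C (u + v * i)) := by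
  intro h
  obtain ⟨s1, s2, -, s4⟩ := power_sums_of_bern_eq_prod (by omega) h
  obtain ⟨l1, l2, -, l4⟩ := sum_range_linear u v n
  have s4 := s4 hn
  rw [l1] at s1
  rw [l2] at s2
  rw [l4] at s4
  obtain ⟨m, rfl⟩ := Nat.exists_eq_add_of_le hn
  have h0 : ((5 + m : ℕ) : ℂ) ≠ 0 := by exact_mod_cast (by omega)
  have h1 : ((5 + m : ℕ) : ℂ) - 1 ≠ 0 := by
    rw [sub_ne_zero]; exact_mod_cast (by omega)
  have h2 : ((5 + m : ℕ) : ℂ) - 2 ≠ 0 := by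
    rw [sub_ne_zero]; exact_mod_cast (by omega)
  have h3 : ((5 + m : ℕ) : ℂ) - 3 ≠ 0 := by
    rw [sub_ne_zero]; exact_mod_cast (by omega)
  set x := ((5 + m : ℕ) : ℂ)
  clear_value x
  have hu : u = -(v * (x - 1) / 2) := by
    apply mul_left_cancel₀ h0
    linear_combination s1
  subst hu
  have hv : v ^ 2 * (x + 1) = 1 := by
    apply mul_left_cancel₀ (mul_ne_zero h0 h1)
    linear_combination 12 * s2
  -- the fourth power sums differ by `n² (n - 1) (n - 2) (n - 3) / (720 (n + 1))`
  apply mul_ne_zero (mul_ne_zero (mul_ne_zero (mul_ne_zero h0 h0) h1) h2) h3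
  have e4 : v ^ 4 * (x * (x - 1) * (x + 1) * (3 * x ^ 2 - 7)) * 6 / 240 =
      3 * (x * (x - 1) / 12) ^ 2 - 7 / 240 * (x * (x - 1) * (x - 2) * (x - 3)) := by
    linear_combination s4
  linear_combination 120 * (x + 1) * e4 - 3 * x * (x - 1) * (3 * x ^ 2 - 7) *
    (v ^ 2 * (x + 1) + 1) * hv

/-- As a polynomial in `(x - 1/2)²`, no `B_{2t} + b` with `t ≥ 5` has roots in arithmetic
progression: the third central moment of the roots is not `0`. -/
theorem bern_ne_prod_sq_linear {t : ℕ} (ht : 5 ≤ t) (u v β : ℂ) :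
    (bern (2 * t)).comp (X + C (1 / 2)) + C β ≠
      ∏ i ∈ Finset.range t, (X ^ 2 - C (u + v * i)) := by
  intro h
  obtain ⟨-, h3⟩ := power_sums_of_bern_eq_prod_sq (by omega) h
  obtain ⟨l1, l2, l3, -⟩ := sum_range_linear u v t
  rw [l1, l2, l3] at h3
  have e : (t : ℂ) ^ 3 * (2 * t - 1) * (t - 1) * (t - 2) * (4 * t ^ 2 - 37 * t + 64) = 0 := by
    linear_combination -7560 * h3
  have e' : (t : ℤ) ^ 3 * (2 * t - 1) * (t - 1) * (t - 2) * (4 * t ^ 2 - 37 * t + 64) = 0 := by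
    exact_mod_cast e
  have hq : (4 * (t : ℤ) ^ 2 - 37 * t + 64) ≠ 0 := by
    rcases le_or_gt t 6 with h6 | h6
    · interval_cases t <;> norm_num
    · have : (7 : ℤ) ≤ t := by exact_mod_cast h6
      nlinarith
  have ht' : (5 : ℤ) ≤ t := by exact_mod_cast ht
  refine mul_ne_zero (mul_ne_zero (mul_ne_zero (mul_ne_zero (pow_ne_zero 3 ?_) ?_) ?_) ?_) hq e' <;>
    omega

theorem odd_sq_factor_ne_zero {t : ℕ} (ht : 3 ≤ t) :
    (t : ℂ) * (t ^ 2 - 1) * (t ^ 2 - 4) * (4 * t ^ 2 - 1) ≠ 0 := by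
  have ht' : (3 : ℤ) ≤ t := by exact_mod_cast ht
  have : (t : ℤ) * (t ^ 2 - 1) * (t ^ 2 - 4) * (4 * t ^ 2 - 1) ≠ 0 := by
    refine mul_ne_zero (mul_ne_zero (mul_ne_zero ?_ ?_) ?_) ?_
    · omega
    all_goals nlinarith
  exact_mod_cast this

/-- The roots of `B_n + b` have third central moment `0` for `n ≥ 4`, unlike the squares of the odd
numbers below `2n`. -/
theorem bern_ne_prod_odd_sq {n : ℕ} (hn : 4 ≤ n) {u v : ℂ} (hv : v ≠ 0) (β : ℂ) :
    (bern n).comp (X + C (1 / 2)) + C β ≠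
      ∏ i ∈ Finset.range n, (X - C (u + v * (2 * i + 1) ^ 2)) := by
  intro h
  obtain ⟨s1, s2, s3, -⟩ := power_sums_of_bern_eq_prod (by omega) h
  have s3 := s3 hn
  obtain ⟨l1, l2, l3⟩ := sum_range_odd_sq u v n
  -- the third central moment is invariant under translation
  have e : (n : ℂ) ^ 2 * (∑ i ∈ Finset.range n, (u + v * (2 * i + 1) ^ 2) ^ 3) -
      3 * n * (∑ i ∈ Finset.range n, (u + v * (2 * i + 1) ^ 2)) *
        (∑ i ∈ Finset.range n, (u + v * (2 * i + 1) ^ 2) ^ 2) +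
      2 * (∑ i ∈ Finset.range n, (u + v * (2 * i + 1) ^ 2)) ^ 3 = 0 := by
    rw [s1, s3]; ring
  rw [l1, l2, l3] at e
  have hn0 : (n : ℂ) ≠ 0 := by exact_mod_cast (show n ≠ 0 by omega)
  apply mul_ne_zero (mul_ne_zero (pow_ne_zero 3 hv) (pow_ne_zero 2 hn0))
    (odd_sq_factor_ne_zero (show 3 ≤ n by omega))
  linear_combination 945 / 256 * e

theorem pos_of_sq_of_cube {v : ℂ} {r s : ℝ} (h2 : v ^ 2 = r) (h3 : v ^ 3 = s) (hv : v ≠ 0) :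
    0 < r := by
  have hr : (r : ℂ) ≠ 0 := by rw [← h2]; exact pow_ne_zero 2 hv
  have hv' : v = ((s / r : ℝ) : ℂ) := by
    push_cast
    rw [eq_div_iff hr, ← h2, ← h3]; ring
  have : r = (s / r) ^ 2 := by
    rw [hv'] at h2
    exact_mod_cast h2.symm
  refine lt_of_le_of_ne (this ▸ sq_nonneg _) ?_
  intro h0
  exact hr (by rw [← h0]; simp)

/-- For `t ≥ 4` the roots of `B_{2t} + b`, as a polynomial in `(x - 1/2)²`, have a nonpositive
second central moment, while affine images of the squares of odd numbers with the right third
moment have a positive one. -/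
theorem bern_ne_prod_sq_odd_sq {t : ℕ} (ht : 4 ≤ t) {u v : ℂ} (hv : v ≠ 0) (β : ℂ) :
    (bern (2 * t)).comp (X + C (1 / 2)) + C β ≠
      ∏ i ∈ Finset.range t, (X ^ 2 - C (u + v * (2 * i + 1) ^ 2)) := by
  intro h
  obtain ⟨h2, h3⟩ := power_sums_of_bern_eq_prod_sq ht h
  obtain ⟨l1, l2, l3⟩ := sum_range_odd_sq u v t
  rw [l1, l2] at h2
  rw [l1, l2, l3] at h3
  have ht' : (4 : ℝ) ≤ t := by exact_mod_cast ht
  have hD := odd_sq_factor_ne_zero (show 3 ≤ t by omega)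
  obtain ⟨⟨⟨ht0, hD1⟩, hD2⟩, hD3⟩ : (((t : ℂ) ≠ 0 ∧ (t : ℂ) ^ 2 - 1 ≠ 0) ∧ (t : ℂ) ^ 2 - 4 ≠ 0) ∧
      4 * (t : ℂ) ^ 2 - 1 ≠ 0 := by simpa only [mul_ne_zero_iff] using hD
  -- the second central moments force `v² ≤ 0`, the third ones force `v` to be real
  have e2 : v ^ 2 = ((-((2 * t - 1) * (t - 1) * (t - 4) / 64 /
      ((t ^ 2 - 1) * (4 * t ^ 2 - 1))) : ℝ) : ℂ) := by
    push_cast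
    rw [div_div, ← neg_div, eq_div_iff (mul_ne_zero (by norm_num) (mul_ne_zero hD1 hD3))]
    apply mul_left_cancel₀ (pow_ne_zero 2 ht0)
    linear_combination 180 * h2
  have e3 : v ^ 3 = (((2 * t - 1) * (t - 1) * (t - 2) * (4 * t ^ 2 - 37 * t + 64) / 2048 /
      ((t ^ 2 - 1) * (t ^ 2 - 4) * (4 * t ^ 2 - 1)) : ℝ) : ℂ) := by
    push_cast
    rw [div_div, eq_div_iff (mul_ne_zero (by norm_num) (mul_ne_zero (mul_ne_zero hD1 hD2) hD3))]
    apply mul_left_cancel₀ (pow_ne_zero 3 ht0)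
    linear_combination 7560 * h3
  have hpos := pos_of_sq_of_cube e2 e3 hv
  have : 0 ≤ (2 * (t : ℝ) - 1) * (t - 1) * (t - 4) / 64 / ((t ^ 2 - 1) * (4 * t ^ 2 - 1)) := by
    apply div_nonneg
    · apply div_nonneg _ (by norm_num)
      refine mul_nonneg (mul_nonneg ?_ ?_) ?_ <;> linarith
    · apply mul_nonneg <;> nlinarith
  linarith

theorem sq_of_bern_three_eq_prod_linear {u v β : ℂ}
    (h : (bern 3).comp (X + C (1 / 2)) + C β = ∏ i ∈ Finset.range 3, (X - C (u + v * i))) :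
    v ^ 2 = 1 / 4 ∧ β = 0 := by
  obtain ⟨s1, s2, -⟩ := power_sums_of_bern_eq_prod le_rfl h
  have h0 := congrArg (eval 0) h
  obtain ⟨-, -, -, b3, -⟩ := bern_half_values
  simp only [Finset.sum_range_succ, Finset.sum_range_zero, Finset.prod_range_succ,
    Finset.prod_range_zero] at s1 s2 h0
  simp only [eval_add, eval_mul, eval_sub, eval_comp, eval_X, eval_C, eval_one, zero_add, b3] at h0
  push_cast at s1 s2 h0
  have hu : u = -v := by linear_combination s1 / 3
  subst hu
  exact ⟨by linear_combination s2 / 2, by linear_combination h0⟩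

theorem sq_of_bern_three_eq_prod_odd_sq {u v β : ℂ}
    (h : (bern 3).comp (X + C (1 / 2)) + C β =
      ∏ i ∈ Finset.range 3, (X - C (u + v * (2 * i + 1) ^ 2))) :
    v ^ 2 = 3 / 1792 := by
  obtain ⟨s1, s2, -⟩ := power_sums_of_bern_eq_prod le_rfl h
  simp only [Finset.sum_range_succ, Finset.sum_range_zero] at s1 s2
  push_cast at s1 s2
  have hu : u = -(35 / 3) * v := by linear_combination s1 / 3
  subst hu
  linear_combination 3 / 896 * s2

/-! ### From square roots to polynomial decompositions -/

/-- The polynomial `∏_{i < m} (x - ((2i + 1) c / 2)²)`, the outer factor in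
`R_c^{2m}(x) = E((x + (2m - 1) c / 2)²)`. -/
noncomputable def oddSqProd (c : ℂ) (m : ℕ) : ℂ[X] :=
  ∏ i ∈ Finset.range m, (X - C (((2 * i + 1) * c / 2) ^ 2))

theorem prod_even_eq (c : ℂ) (m : ℕ) (z : ℂ) :
    ∏ i ∈ Finset.range (2 * m), (z + i * c) =
      ∏ i ∈ Finset.range m, ((z + (2 * m - 1) * c / 2) ^ 2 - ((2 * i + 1) * c / 2) ^ 2) := by
  induction m generalizing z with
  | zero => simp
  | succ m ih =>
    rw [show 2 * (m + 1) = 2 * m + 1 + 1 by ring, Finset.prod_range_succ, Finset.prod_range_succ',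
      Finset.prod_range_succ]
    have h1 : ∀ i : ℕ, z + ((i + 1 : ℕ) : ℂ) * c = (z + c) + i * c := fun i => by push_cast; ring
    simp only [h1, ih]
    push_cast
    have h2 : z + c + (2 * m - 1) * c / 2 = z + (2 * (m + 1) - 1) * c / 2 := by ring
    rw [h2]
    ring

theorem eval_oddSqProd (c : ℂ) (m : ℕ) (z : ℂ) :
    (oddSqProd c m).eval z = ∏ i ∈ Finset.range m, (z - ((2 * i + 1) * c / 2) ^ 2) := by
  simp [oddSqProd, eval_prod]

/-- Every polynomial is `e(x²) + x o(x²)`. -/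
theorem exists_even_odd_parts (f : ℂ[X]) :
    ∃ e o : ℂ[X], f = expand ℂ 2 e + X * expand ℂ 2 o := by
  induction f using Polynomial.induction_on' with
  | add p q hp hq =>
    obtain ⟨e, o, h⟩ := hp
    obtain ⟨e', o', h'⟩ := hq
    refine ⟨e + e', o + o', ?_⟩
    rw [h, h', map_add, map_add]
    ring
  | monomial n a =>
    rcases Nat.even_or_odd' n with ⟨m, rfl | rfl⟩
    · refine ⟨monomial m a, 0, ?_⟩
      rw [expand_monomial, map_zero, mul_zero, add_zero, mul_comm]
    · refine ⟨0, monomial m a, ?_⟩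
      rw [expand_monomial, map_zero, zero_add, X_mul_monomial, mul_comm 2]

theorem natDegree_prod_X_sub_C (ρ : ℕ → ℂ) (t : ℕ) :
    (∏ i ∈ Finset.range t, (X - C (ρ i))).natDegree = t := by
  rw [natDegree_prod_of_monic _ _ fun i _ => monic_X_sub_C _]
  simp

/-- If `∏ (x + δ + ic)` over `i < l` is an even polynomial, then `l` is even and the roots are
centred at `0`. -/
theorem even_of_prod_eq_expand {c δ : ℂ} {l : ℕ} {e : ℂ[X]} (hl : l ≠ 0)
    (h : ∏ i ∈ Finset.range l, (X - C (-δ + -c * i)) = expand ℂ 2 e) :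
    ∃ m, l = 2 * m ∧ δ = -((2 * m - 1) * c / 2) := by
  have hdeg := natDegree_prod_X_sub_C (fun i : ℕ => -δ + -c * i) l
  rw [h, natDegree_expand] at hdeg
  refine ⟨e.natDegree, by omega, ?_⟩
  obtain ⟨-, h1, -⟩ := reflect_prod_values (fun i : ℕ => -δ + -c * i) l
  rw [(sum_range_linear _ _ l).1, h, coeff_reflect, revAt_le (by omega), coeff_expand (by norm_num),
    if_neg (by omega)] at h1
  have hl0 : (l : ℂ) ≠ 0 := by exact_mod_cast hl
  have hl' : (l : ℂ) = 2 * e.natDegree := by rw [← hdeg]; push_cast; ring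
  apply mul_left_cancel₀ hl0
  rw [hl'] at h1 ⊢
  linear_combination -h1

/-- Removal of the square root: a representation of `S` through `p √q` gives one through
polynomials. -/
theorem exists_polynomial_representation {S : ℂ[X]} (hS : S.natDegree ≠ 0) {c δ : ℂ} {l : ℕ}
    (hl : l ≠ 0) {p q : ℂ[X]} (hq : q.natDegree ≤ 2) {w : ℂ → ℂ} (hw : ∀ x, w x ^ 2 = q.eval x)
    (h : ∀ x, S.eval x = ∏ i ∈ Finset.range l, (p.eval x * w x + δ + i * c)) :
    (Odd l ∧ ∃ P : ℂ[X], S = (∏ i ∈ Finset.range l, (X - C (0 + -c * i))).comp P) ∨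
    ∃ (m : ℕ) (p q : ℂ[X]), l = 2 * m ∧ q.natDegree ≤ 2 ∧ S = (oddSqProd c m).comp (p ^ 2 * q) := by
  obtain ⟨e, o, heo⟩ := exists_even_odd_parts (∏ i ∈ Finset.range l, (X - C (-δ + -c * i)))
  have hG : ∀ z, ∏ i ∈ Finset.range l, (z + δ + i * c) = e.eval (z ^ 2) + z * o.eval (z ^ 2) := by
    intro z
    have := congrArg (eval z) heo
    simp only [eval_prod, eval_sub, eval_X, eval_C, eval_add, eval_mul, expand_eval] at this
    rw [← this]
    refine Finset.prod_congr rfl fun i _ => ?_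
    ring
  have hy : ∀ x, (p.eval x * w x) ^ 2 = (p ^ 2 * q).eval x := fun x => by
    rw [mul_pow, hw]; simp
  set Q := p ^ 2 * q with hQ
  have hS' : ∀ x, S.eval x = e.eval (Q.eval x) + p.eval x * w x * o.eval (Q.eval x) := fun x => by
    rw [h, hG, hy]
  have hsq : (S - e.comp Q) ^ 2 = Q * (o.comp Q) ^ 2 := by
    apply Polynomial.funext
    intro x
    simp only [eval_pow, eval_sub, eval_mul, eval_comp]
    have h1 := hy x
    have h2 := hS' x
    rw [h2]
    linear_combination (o.eval (Q.eval x)) ^ 2 * h1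
  by_cases hB : o.comp Q = 0
  · -- the odd part does not contribute, so it vanishes
    right
    have hSe : S = e.comp Q := by
      rw [hB] at hsq
      have : (S - e.comp Q) ^ 2 = 0 := by rw [hsq]; ring
      exact sub_eq_zero.mp (pow_eq_zero_iff (two_ne_zero) |>.mp this)
    have ho : o = 0 := by
      rcases comp_eq_zero_iff.mp hB with h0 | ⟨-, h1⟩
      · exact h0
      · exfalso
        apply hS
        rw [hSe, natDegree_comp, h1, natDegree_C, mul_zero]
    rw [ho, map_zero, mul_zero, add_zero] at heo
    obtain ⟨m, hm, hδ⟩ := even_of_prod_eq_expand hl heo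
    refine ⟨m, p, q, hm, hq, ?_⟩
    apply Polynomial.funext
    intro x
    have := h x
    rw [hm] at this
    rw [this, eval_comp, eval_oddSqProd]
    have e2 := prod_even_eq c m (p.eval x * w x + δ)
    rw [show p.eval x * w x + δ + (2 * m - 1) * c / 2 = p.eval x * w x by rw [hδ]; ring] at e2
    rw [e2, ← hQ]
    simp only [hy]
  · -- `Q` is the square of a polynomial `D`, which replaces the square root
    obtain ⟨D, hD⟩ : o.comp Q ∣ S - e.comp Q := by
      rw [← IsIntegrallyClosed.pow_dvd_pow_iff (n := 2) two_ne_zero]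
      exact ⟨Q, by rw [hsq]; ring⟩
    have hDQ : D ^ 2 = Q := by
      rw [hD] at hsq
      apply mul_left_cancel₀ (pow_ne_zero 2 hB)
      linear_combination hsq
    have hSD : ∀ x, S.eval x = ∏ i ∈ Finset.range l, (D.eval x + δ + i * c) := by
      intro x
      have := congrArg (eval x) hD
      simp only [eval_sub, eval_mul, eval_comp] at this
      rw [hG, ← eval_pow, hDQ]
      linear_combination this
    rcases Nat.even_or_odd' l with ⟨m, hm | hm⟩
    · right
      refine ⟨m, D + C (δ + (2 * m - 1) * c / 2), 1, hm, by simp, ?_⟩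
      apply Polynomial.funext
      intro x
      have := hSD x
      rw [hm, prod_even_eq] at this
      rw [this, eval_comp, eval_oddSqProd]
      refine Finset.prod_congr rfl fun i _ => ?_
      simp
      ring
    · left
      refine ⟨⟨m, hm⟩, D + C δ, ?_⟩
      apply Polynomial.funext
      intro x
      rw [hSD, eval_comp, eval_prod]
      refine Finset.prod_congr rfl fun i _ => ?_
      simp
      ring

/-- Normal form of a decomposition of `B_n` with inner factor affinely equivalent to
`(x - 1/2)^d`. -/
theorem bern_eq_prod_of_eq_comp {n d t : ℕ} (hn : n ≠ 0) {a b κ u v : ℂ} {ρ : ℕ → ℂ} {g : ℂ[X]}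
    (hd : d ≠ 0) (hu : u ≠ 0) (hg : g = C u * (X - C (1 / 2)) ^ d + C v)
    (h : bern n = (C b + C κ * ∏ i ∈ Finset.range t, (X - C (ρ i))).comp g) (ha : a = -b) :
    (bern n).comp (X + C (1 / 2)) + C a = ∏ i ∈ Finset.range t, (X ^ d - C ((ρ i - v) / u)) ∧
      κ * u ^ t = 1 ∧ n = t * d := by
  have hprod : (bern n).comp (X + C (1 / 2)) + C a =
      C (κ * u ^ t) * ∏ i ∈ Finset.range t, (X ^ d - C ((ρ i - v) / u)) := by
    have hgX : g.comp (X + C (1 / 2)) = C u * X ^ d + C v := by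
      rw [hg]
      simp
    rw [h, comp_assoc, hgX, ha, add_comp, mul_comp, C_comp, C_comp, prod_comp]
    have : ∀ i, (X - C (ρ i)).comp (C u * X ^ d + C v) = C u * (X ^ d - C ((ρ i - v) / u)) := by
      intro i
      rw [sub_comp, X_comp, C_comp, mul_sub, ← C_mul, mul_div_cancel₀ _ hu, C_sub]
      ring
    simp only [this, Finset.prod_mul_distrib, Finset.prod_const, Finset.card_range, C_mul, C_pow,
      C_neg]
    ring
  have hmon : ∀ i ∈ Finset.range t, (X ^ d - C ((ρ i - v) / u)).Monic := fun i _ =>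
    monic_X_pow_sub_C _ hd
  have hP : (∏ i ∈ Finset.range t, (X ^ d - C ((ρ i - v) / u))).Monic :=
    monic_prod_of_monic _ _ hmon
  have hPd : (∏ i ∈ Finset.range t, (X ^ d - C ((ρ i - v) / u))).natDegree = t * d := by
    rw [natDegree_prod_of_monic _ _ hmon]
    simp
  have hL : ((bern n).comp (X + C (1 / 2)) + C a).Monic := by
    apply ((monic_bern n).comp_X_add_C _).add_of_left
    refine lt_of_le_of_lt degree_C_le ?_
    rw [degree_eq_natDegree ((monic_bern n).comp_X_add_C _).ne_zero, natDegree_comp,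
      natDegree_X_add_C, natDegree_bern, mul_one]
    exact_mod_cast Nat.pos_of_ne_zero hn
  have hLd : ((bern n).comp (X + C (1 / 2)) + C a).natDegree = n := by
    rw [natDegree_add_C, natDegree_comp, natDegree_X_add_C, natDegree_bern, mul_one]
  have hκ : κ * u ^ t = 1 := by
    have := congrArg leadingCoeff hprod
    rw [hL.leadingCoeff, leadingCoeff_mul, hP.leadingCoeff, leadingCoeff_C, mul_one] at this
    exact this.symm
  rw [hκ, C_1, one_mul] at hprod
  exact ⟨hprod, hκ, by rw [← hLd, hprod, hPd]⟩

/-- The inner factor of a decomposition `B_n = f ∘ g` with `deg f ≥ 2` is affinely equivalent to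
`x - 1/2` or to `(x - 1/2)²`. -/
theorem exists_inner_normal_form {n : ℕ} (hn : n ≠ 0) {f g : ℂ[X]} (h : bern n = f.comp g)
    (hf : 2 ≤ f.natDegree) :
    ∃ (d : ℕ) (u v : ℂ), (d = 1 ∨ d = 2) ∧ u ≠ 0 ∧ g = C u * (X - C (1 / 2)) ^ d + C v := by
  rcases Nat.lt_or_ge g.natDegree 2 with h2 | h2
  · have hg : g.natDegree = 1 := by
      have := congrArg natDegree h
      rw [natDegree_comp, natDegree_bern] at this
      rcases Nat.eq_zero_or_pos g.natDegree with h0 | h0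
      · rw [h0, mul_zero] at this; exact absurd this hn
      · omega
    refine ⟨1, g.coeff 1, g.coeff 0 + g.coeff 1 * (1 / 2), Or.inl rfl, ?_, ?_⟩
    · rw [← hg]
      intro h0
      rw [coeff_natDegree, leadingCoeff_eq_zero] at h0
      rw [h0, natDegree_zero] at hg
      exact absurd hg (by norm_num)
    · conv_lhs => rw [eq_X_add_C_of_natDegree_le_one hg.le]
      rw [C_add, C_mul]
      ring
  · obtain ⟨u, v, hu, hg⟩ := eq_sq_of_bern_eq_comp h hf h2
    exact ⟨2, u, v, Or.inr rfl, hu, hg⟩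

/-! ### Power sums along arithmetic progressions -/

theorem map_powerSumPoly (a b : ℤ) (k : ℕ) :
    (powerSumPoly a b k).map (algebraMap ℚ ℂ) =
      C ((a : ℂ) ^ k / (k + 1)) * ((bern (k + 1)).comp (X + C ((b : ℂ) / a)) -
        C ((((Polynomial.bernoulli (k + 1)).eval ((b : ℚ) / a) : ℚ) : ℂ))) := by
  rw [powerSumPoly, Polynomial.map_mul, Polynomial.map_sub, map_comp, map_C, map_C,
    Polynomial.map_add, map_X, map_C, bern]
  simp

theorem aeval_progressionPoly (c : ℤ) (l : ℕ) (z : ℂ) :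
    aeval z (progressionPoly c l) = ∏ i ∈ Finset.range l, (z + i * (c : ℂ)) := by
  simp [progressionPoly, map_prod]

/-- A decomposition of `S_{a,b}^k` gives one of `B_{k+1}`, with an inner factor translated by
`b/a`. -/
theorem bern_eq_of_powerSumPoly {a b : ℤ} {k : ℕ} (ha : a ≠ 0) {f g : ℂ[X]}
    (h : (powerSumPoly a b k).map (algebraMap ℚ ℂ) = f.comp g) :
    bern (k + 1) = (C (((Polynomial.bernoulli (k + 1)).eval ((b : ℚ) / a) : ℚ) : ℂ) +
      C ((a : ℂ) ^ k / (k + 1))⁻¹ * f).comp (g.comp (X - C ((b : ℂ) / a))) := by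
  rw [map_powerSumPoly] at h
  have hK : ((a : ℂ) ^ k / (k + 1)) ≠ 0 := by
    apply div_ne_zero
    · exact pow_ne_zero _ (by exact_mod_cast ha)
    · exact_mod_cast Nat.succ_ne_zero k
  rw [add_comp, mul_comp, C_comp, C_comp, ← comp_assoc, ← h, mul_comp, C_comp, sub_comp, C_comp,
    comp_assoc, ← mul_assoc, ← C_mul, inv_mul_cancel₀ hK]
  simp

theorem bernoulli_three_eval (r : ℚ) :
    (Polynomial.bernoulli 3).eval r = r * (r - 1 / 2) * (r - 1) := by
  rw [Polynomial.bernoulli]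
  simp only [Finset.sum_range_succ, Finset.sum_range_zero, bernoulli_three,
    _root_.bernoulli_zero, _root_.bernoulli_one, _root_.bernoulli_two, Nat.choose]
  norm_num
  ring

theorem sq_ne_of_not_isSquare {N : ℕ} (hN : ¬ IsSquare N) (q : ℚ) : q ^ 2 ≠ N := by
  intro h
  exact hN (Rat.isSquare_natCast_iff.mp ⟨q, by rw [← h, pow_two]⟩)

theorem not_three_mul_pow_four {a c : ℤ} (ha : a ≠ 0) : 112 ^ 3 * c ^ 12 ≠ 3 * a ^ 4 := by
  intro h
  have haQ : (a : ℚ) ≠ 0 := by exact_mod_cast ha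
  have hQ : (112 : ℚ) ^ 3 * c ^ 12 = 3 * a ^ 4 := by exact_mod_cast h
  have h21 : ¬ IsSquare 21 := by
    rintro ⟨r, hr⟩
    have : r ≤ 4 := by nlinarith
    interval_cases r <;> omega
  apply sq_ne_of_not_isSquare h21 (3136 * c ^ 6 / a ^ 2)
  field_simp
  push_cast
  linear_combination 7 * hQ

/-- No `B_3 + b` with rational `b` is of the form `p² q` with `deg q ≤ 2`: its double root would
make `3` a rational square. -/
theorem bern_three_add_const_ne_sq_mul (b : ℚ) {p q : ℂ[X]} (hq : q.natDegree ≤ 2) :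
    bern 3 + C (b : ℂ) ≠ p ^ 2 * q := by
  intro h
  have hdeg : (bern 3 + C (b : ℂ)).natDegree = 3 := by rw [natDegree_add_C, natDegree_bern]
  have hne : bern 3 + C (b : ℂ) ≠ 0 := by
    intro h0; rw [h0, natDegree_zero] at hdeg; omega
  have hp : p.natDegree ≠ 0 := by
    intro h0
    have := natDegree_mul_le (p := p ^ 2) (q := q)
    rw [← h, hdeg, natDegree_pow, h0] at this
    omega
  obtain ⟨x, hx⟩ := IsAlgClosed.exists_root p (by
    intro h0
    exact hp (natDegree_eq_of_degree_eq_some h0))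
  have hx : p.eval x = 0 := hx
  have h1 := congrArg (eval x) h
  have h2 := congrArg (fun f => (derivative f).eval x) h
  simp only [derivative_add, derivative_C, derivative_mul, derivative_sq, eval_add, eval_mul,
    eval_pow, hx, eval_zero, eval_C] at h1 h2
  have hb3 : bern 3 = X ^ 3 + C (-3 / 2) * X ^ 2 + C (1 / 2) * X := by
    rw [(monic_bern 3).as_sum, natDegree_bern]
    simp only [Finset.sum_range_succ, Finset.sum_range_zero, bern, coeff_map,
      Polynomial.coeff_bernoulli]
    norm_num [_root_.bernoulli_two, _root_.bernoulli_one, bernoulli_three, Nat.choose]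
    ring
  rw [hb3] at h1 h2
  simp at h1 h2
  have hy : x - 1 / 2 = 6 * b := by linear_combination -6 * h1 + 2 * (x - 1 / 2) * h2
  have h3 : ¬ IsSquare 3 := by
    rintro ⟨r, hr⟩
    have : r ≤ 1 := by nlinarith
    interval_cases r <;> omega
  apply sq_ne_of_not_isSquare h3 (36 * b)
  have : (36 * (b : ℂ)) ^ 2 = 3 := by
    rw [show 36 * (b : ℂ) = 6 * (6 * b) by ring, ← hy]
    linear_combination 12 * h2
  exact_mod_cast this

/-- Odd `l`: `S_{a,b}^k` is not `R_c^l ∘ P`. When `k = 2` and `l = 3` the decomposition exists for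
some `a`, `c` if `b/a ∈ {0, 1/2, 1}`, and coprimality of `a` and `b` then bounds `a`. -/
theorem powerSumPoly_ne_comp_odd {a b c : ℤ} (ha : a ≠ 0) (hc : c ≠ 0) (hab : IsCoprime a b)
    {k l : ℕ} (hk : 2 ≤ k) (hk5 : k ≠ 5) (hl : 2 ≤ l) (hodd : Odd l) (P : ℂ[X]) :
    (powerSumPoly a b k).map (algebraMap ℚ ℂ) ≠
      (∏ i ∈ Finset.range l, (X - C (0 + -(c : ℂ) * i))).comp P := by
  intro h
  have hcC : (c : ℂ) ≠ 0 := by exact_mod_cast hc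
  have haC : (a : ℂ) ≠ 0 := by exact_mod_cast ha
  have hB := bern_eq_of_powerSumPoly ha h
  have hK : ((a : ℂ) ^ k / (k + 1))⁻¹ ≠ 0 := by
    apply inv_ne_zero
    apply div_ne_zero
    · exact pow_ne_zero _ haC
    · exact_mod_cast Nat.succ_ne_zero k
  obtain ⟨d, u, v, hd, hu, hg⟩ := exists_inner_normal_form (Nat.succ_ne_zero k) hB (by
    rw [natDegree_C_add, natDegree_C_mul hK, natDegree_prod_X_sub_C]; exact hl)
  obtain ⟨hprod, hκ, hn⟩ := bern_eq_prod_of_eq_comp (Nat.succ_ne_zero k) (by omega) hu hg hB rfl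
  have hσ : ∀ i : ℕ, (0 + -(c : ℂ) * i - v) / u = -v / u + (-c / u) * i := fun i => by ring
  simp only [hσ] at hprod
  obtain ⟨m, hm⟩ := hodd
  rcases hd with rfl | rfl
  · rw [mul_one] at hn
    simp only [pow_one] at hprod
    rw [← hn] at hprod
    rcases (show k = 2 ∨ 5 ≤ k + 1 by omega) with rfl | h5
    · obtain ⟨hv, hβ⟩ := sq_of_bern_three_eq_prod_linear hprod
      -- `b / a` is a root of `B_3`, hence `a ∣ 2`
      have hβ' : (Polynomial.bernoulli 3).eval ((b : ℚ) / a) = 0 := by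
        exact_mod_cast neg_eq_zero.mp hβ
      rw [bernoulli_three_eval] at hβ'
      have haQ : (a : ℚ) ≠ 0 := by exact_mod_cast ha
      have hz : (b : ℤ) * (2 * b - a) * (b - a) = 0 := by
        have : (b : ℚ) * (2 * b - a) * (b - a) =
            2 * a ^ 3 * ((b : ℚ) / a * ((b : ℚ) / a - 1 / 2) * ((b : ℚ) / a - 1)) := by
          field_simp
        rw [hβ', mul_zero] at this
        exact_mod_cast this
      have ha2 : a ∣ 2 := by
        have h1 : a ∣ 2 * b ^ 3 := ⟨3 * b ^ 2 - a * b, by linear_combination hz⟩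
        exact (hab.pow_right (n := 3)).dvd_of_dvd_mul_right h1
      have hle : |a| ≤ 2 := Int.le_of_dvd (by norm_num) ((abs_dvd a 2).mpr ha2)
      have hu2 : u ^ 2 = 4 * c ^ 2 := by
        field_simp at hv
        linear_combination -hv
      have hl3 : l = 3 := by omega
      rw [hl3] at hκ
      have hu3 : u ^ 3 = (a : ℂ) ^ 2 / 3 := by
        push_cast at hκ
        field_simp at hκ
        linear_combination hκ / 3
      have hac : (a : ℂ) ^ 4 = 576 * c ^ 6 := by
        have : (u ^ 3) ^ 2 = (u ^ 2) ^ 3 := by ring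
        rw [hu3, hu2] at this
        linear_combination 9 * this
      have hac' : a ^ 4 = 576 * c ^ 6 := by exact_mod_cast hac
      have hc6 : 1 ≤ c ^ 6 := Int.add_one_le_iff.mpr (Even.pow_pos (by decide) hc)
      have ha4 : a ^ 4 ≤ 16 := by
        obtain ⟨h1, h2⟩ := abs_le.mp hle
        nlinarith [sq_nonneg a, mul_nonneg (sub_nonneg.mpr h2) (neg_le_iff_add_nonneg.mp h1)]
      omega
    · exact bern_ne_prod_linear h5 _ _ _ hprod
  · rw [mul_comm] at hn
    rw [hn] at hprod
    exact bern_ne_prod_sq_linear (by omega) _ _ _ hprod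

/-- Even `l = 2m ≥ 4`. When `k = 2` and `m = 3` a decomposition exists over `ℂ` for suitable complex
parameters, but its leading coefficient would make `21` a rational square. -/
theorem powerSumPoly_ne_comp_oddSqProd {a b c : ℤ} (ha : a ≠ 0) (hc : c ≠ 0)
    {k m : ℕ} (hk : 2 ≤ k) (hk3 : k ≠ 3) (hk5 : k ≠ 5) (hm : 2 ≤ m) (P : ℂ[X]) :
    (powerSumPoly a b k).map (algebraMap ℚ ℂ) ≠ (oddSqProd c m).comp P := by
  intro h
  have hcC : (c : ℂ) ≠ 0 := by exact_mod_cast hc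
  have haC : (a : ℂ) ≠ 0 := by exact_mod_cast ha
  have hB := bern_eq_of_powerSumPoly ha h
  have hK : ((a : ℂ) ^ k / (k + 1))⁻¹ ≠ 0 := by
    apply inv_ne_zero
    apply div_ne_zero
    · exact pow_ne_zero _ haC
    · exact_mod_cast Nat.succ_ne_zero k
  rw [oddSqProd] at hB
  obtain ⟨d, u, v, hd, hu, hg⟩ := exists_inner_normal_form (Nat.succ_ne_zero k) hB (by
    rw [natDegree_C_add, natDegree_C_mul hK, natDegree_prod_X_sub_C]; exact hm)
  obtain ⟨hprod, hκ, hn⟩ := bern_eq_prod_of_eq_comp (Nat.succ_ne_zero k) (by omega) hu hg hB rfl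
  have hσ : ∀ i : ℕ, (((2 * i + 1) * (c : ℂ) / 2) ^ 2 - v) / u =
      -v / u + (c ^ 2 / (4 * u)) * (2 * i + 1) ^ 2 := fun i => by field_simp; ring
  simp only [hσ] at hprod
  have hv : (c : ℂ) ^ 2 / (4 * u) ≠ 0 :=
    div_ne_zero (pow_ne_zero 2 hcC) (mul_ne_zero (by norm_num) hu)
  rcases hd with rfl | rfl
  · rw [mul_one] at hn
    simp only [pow_one] at hprod
    rw [← hn] at hprod
    rcases (show k = 2 ∨ 4 ≤ k + 1 by omega) with rfl | h4
    · have h2 := sq_of_bern_three_eq_prod_odd_sq hprod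
      have hu2 : 3 * u ^ 2 = 112 * c ^ 4 := by
        field_simp at h2
        linear_combination -h2 / 16
      rw [← hn] at hκ
      have hu3 : u ^ 3 = (a : ℂ) ^ 2 / 3 := by
        push_cast at hκ
        field_simp at hκ
        linear_combination hκ / 3
      apply not_three_mul_pow_four (c := c) ha
      have : (112 : ℂ) ^ 3 * c ^ 12 = 3 * a ^ 4 := by
        have : 27 * (u ^ 3) ^ 2 = (3 * u ^ 2) ^ 3 := by ring
        rw [hu3, hu2] at this
        linear_combination -this
      exact_mod_cast this
    · exact bern_ne_prod_odd_sq h4 hv _ hprod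
  · rw [mul_comm] at hn
    rw [hn] at hprod
    exact bern_ne_prod_sq_odd_sq (by omega) hv _ hprod

/-- The case `l = 2`, where any polynomial can be the inner factor, so that the shape `p² q` of the
inner factor has to be used. -/
theorem powerSumPoly_add_const_ne_sq_mul {a b c : ℤ} (ha : a ≠ 0)
    {k : ℕ} (hk : 2 ≤ k) (hk3 : k ≠ 3) (hk5 : k ≠ 5) {p q : ℂ[X]} (hq : q.natDegree ≤ 2) :
    (powerSumPoly a b k).map (algebraMap ℚ ℂ) ≠ (oddSqProd c 1).comp (p ^ 2 * q) := by
  intro h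
  have hB := bern_eq_of_powerSumPoly ha h
  set r := (b : ℂ) / a
  set β := (Polynomial.bernoulli (k + 1)).eval ((b : ℚ) / a)
  set K := ((a : ℂ) ^ k / (k + 1))⁻¹ with hK
  have hE : oddSqProd c 1 = X - C ((c : ℂ) ^ 2 / 4) := by
    simp [oddSqProd]
    rw [← C_pow, div_pow]
    norm_num
  have hB' : bern (k + 1) + C (((((a : ℚ) ^ k / (k + 1))⁻¹ * ((c : ℚ) ^ 2 / 4) - β : ℚ)) : ℂ) =
      (p.comp (X - C r)) ^ 2 * (C K * q.comp (X - C r)) := by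
    have e : ((((a : ℚ) ^ k / (k + 1))⁻¹ * ((c : ℚ) ^ 2 / 4) - β : ℚ) : ℂ) =
        K * ((c : ℂ) ^ 2 / 4) - β := by
      rw [hK]; push_cast; ring
    rw [e, hB, hE]
    simp only [add_comp, mul_comp, C_comp, sub_comp, X_comp, pow_comp, C_sub, C_mul]
    ring
  have hq' : (C K * q.comp (X - C r)).natDegree ≤ 2 := by
    refine (natDegree_C_mul_le _ _).trans ?_
    rw [natDegree_comp, natDegree_X_sub_C, mul_one]
    exact hq
  rcases (show k = 2 ∨ 5 ≤ k + 1 by omega) with rfl | h5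
  · exact bern_three_add_const_ne_sq_mul _ hq' hB'
  · exact bern_add_const_ne_sq_mul h5 (by omega) _ hq' hB'

theorem lemma2p7 (a b c : ℤ) (ha : a ≠ 0) (hc : c ≠ 0) (hab : IsCoprime a b)
    (k l : ℕ) (hk : 2 ≤ k) (hk3 : k ≠ 3) (hk5 : k ≠ 5) (hl : 2 ≤ l) :
    ¬ ∃ (p : ℂ[X]) (α β γ δ : ℂ) (w : ℂ → ℂ),
      (∀ x : ℂ, w x ^ 2 = α * x ^ 2 + β * x + γ) ∧
      ∀ x : ℂ, aeval x (powerSumPoly a b k) =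
        aeval (p.eval x * w x + δ) (progressionPoly c l) := by
  rintro ⟨p, α, β, γ, δ, w, hw, h⟩
  have hK : (a : ℂ) ^ k / (k + 1) ≠ 0 := by
    apply div_ne_zero
    · exact pow_ne_zero _ (by exact_mod_cast ha)
    · exact_mod_cast Nat.succ_ne_zero k
  have hdeg : ((powerSumPoly a b k).map (algebraMap ℚ ℂ)).natDegree ≠ 0 := by
    rw [map_powerSumPoly, natDegree_C_mul hK, natDegree_sub_C, natDegree_comp, natDegree_X_add_C,
      natDegree_bern]
    omega
  have h' : ∀ x, ((powerSumPoly a b k).map (algebraMap ℚ ℂ)).eval x =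
      ∏ i ∈ Finset.range l, (p.eval x * w x + δ + i * (c : ℂ)) := fun x => by
    rw [eval_map_algebraMap, h, aeval_progressionPoly]
  rcases exists_polynomial_representation hdeg (by omega)
      (natDegree_quadratic_le (a := α) (b := β) (c := γ)) (fun x => by rw [hw]; simp) h' with
    ⟨hodd, P, hP⟩ | ⟨m, p', q', hm, hq', hS⟩
  · exact powerSumPoly_ne_comp_odd ha hc hab hk hk5 hl hodd P hP
  · rcases (show m = 1 ∨ 2 ≤ m by omega) with rfl | hm2
    · exact powerSumPoly_add_const_ne_sq_mul ha hk hk3 hk5 hq' hS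
    · exact powerSumPoly_ne_comp_oddSqProd ha hc hk hk3 hk5 hm2 _ hS
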